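/- Speed scaling with a common deadline and predicted release times. Jobs $1,\dots,n$ with integral release times $r_1\le\dots\le r_n<d$, workloads $w_i\ge 0$ and common deadline $d$ are scheduled online on one processor whose speed can be chosen at every time; a schedule with speed $s(t)$ uses energy $\int s(t)^\alpha\,dt$, where $\alpha>1$. The workloads, $d$, and predictions $p_i<d$ of the release times are known in advance; $r_i$ is revealed at time $r_i$. Let $\eta_i=|p_i-r_i|/(d-p_i)$, $\eta=\max_i\eta_i$, fix $0\le\lambda<1$, and let $p_i'=\lfloor p_i+\lambda(d-p_i)\rfloor$. YDS is the optimal offline algorithm (repeatedly run the jobs of an interval of maximum density at constant speed equal to that density; among the released unfinished jobs, process the one with the earliest release time, ties broken arbitrarily). For a fixed $q\ge1$, qOA runs at each time at $q$ times the speed at which an optimal offline schedule would process the currently unfinished released jobs. Algorithm CDSwP$(\lambda)$: as long as $\eta_i\le\lambda$, at the release of job $i$ it computes the YDS schedule of the instance $J^i$ (common deadline $d$) that consists of one job $i'$ with release time $r_i$ and workload equal to the unfinished workload of jobs $1,\dots,i$, and of every job $j>i$ with release time $p_j'$ and workload $w_j$. It then runs, until the next release, at the profile FtP$(i)$, which equals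 the speed of this schedule at the times at which the schedule runs $i'$, and $0$ otherwise; if all $\eta_i\le\lambda$, the last profile FtP$(n)$ is followed until $d$. If $k$ is the first job with $\eta_k>\lambda$, then from time $r_k$ until $d$ the algorithm runs at the sum of the speed of FtP$(k-1)$ (with FtP$(0)=0$) and the speed of qOA on the jobs $k,\dots,n$. Then, with $\mathcal E_{\mathrm{YDS}}$ and $\mathcal E_{\mathrm{qOA}}$ the energies of YDS and of qOA on the actual instance: (1) if $\eta\le\lambda$, then $$\mathcal E_{\mathrm{CDSwP}(\lambda)}\le\Big(\frac{1+\eta}{1-\lambda}\Big)^{\alpha-1}\mathcal E_{\mathrm{YDS}},$$ and the same bound holds with the energy of any feasible schedule of the actual instance in place of $\mathcal E_{\mathrm{YDS}}$; (2) in all cases, $$\mathcal E_{\mathrm{CDSwP}(\lambda)}\le 2^\alpha\Big(\frac{1+\lambda}{1-\lambda}\Big)^{\alpha-1}\mathcal E_{\mathrm{qOA}}.$$ -/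

import Mathlib

open MeasureTheory
open scoped ENNReal

namespace SpeedScaling

/-- The energy `∫ s(t)^α dt` of a (nonnegative) speed profile, as an extended nonnegative real. -/
noncomputable def energy (α : ℝ) (s : ℝ → ℝ) : ℝ≥0∞ :=
  ∫⁻ t, ENNReal.ofReal (s t ^ α)

/-- A schedule on one speed-scalable processor: the speed at every time, and the job
(if any) that is executed at that time. -/
structure Schedule where
  speed : ℝ → ℝ
  job : ℝ → Option ℕ
  speed_nonneg : ∀ t, 0 ≤ speed t
  measurable_speed : Measurable speed
  measurableSet_job : ∀ j, MeasurableSet {t | job t = some j}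

/-- `S` is feasible for the jobs `j ∈ J` with release times `r j`, workloads `w j` and common
deadline `d`: each job receives at least its workload between its release time and the deadline. -/
def Schedule.Feasible (S : Schedule) (J : Finset ℕ) (r w : ℕ → ℝ) (d : ℝ) : Prop :=
  ∀ j ∈ J, ENNReal.ofReal (w j) ≤
    ∫⁻ t in {t | t ∈ Set.Icc (r j) d ∧ S.job t = some j}, ENNReal.ofReal (S.speed t)

/-! ### The offline algorithm YDS for a common deadline

YDS repeatedly takes an interval of maximum density (the total workload of the jobs whose
whole life span lies in the interval, divided by the length of the interval), runs these jobs in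
it at a constant speed equal to the density, and removes the jobs and the interval.  If all jobs
have the deadline `D`, an interval of maximum density can be taken of the form `[z, D)` with `z` a
release time, and its removal leaves the jobs released before `z`, with the common deadline `z`. -/

/-- Density of the interval `[z, D)`: the workload released at or after `z`, per time unit. -/
noncomputable def density (J : Finset ℕ) (r w : ℕ → ℝ) (D z : ℝ) : ℝ :=
  (∑ j ∈ J with z ≤ r j, w j) / (D - z)

/-- A job of `J` whose release time `z` maximizes the density of `[z, D)`. -/
noncomputable def criticalJob (J : Finset ℕ) (r w : ℕ → ℝ) (D : ℝ) (h : J.Nonempty) : ℕ :=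
  (J.exists_max_image (fun j => density J r w D (r j)) h).choose

theorem criticalJob_mem (J : Finset ℕ) (r w : ℕ → ℝ) (D : ℝ) (h : J.Nonempty) :
    criticalJob J r w D h ∈ J :=
  (J.exists_max_image (fun j => density J r w D (r j)) h).choose_spec.1

/-- The speed of YDS at time `t` on the jobs `j ∈ J` with release times `r j`, workloads `w j` and
common deadline `D`. -/
noncomputable def ydsSpeed (J : Finset ℕ) (r w : ℕ → ℝ) (D t : ℝ) : ℝ :=
  if h : J.Nonempty then
    if r (criticalJob J r w D h) ≤ t ∧ t < D then
      density J r w D (r (criticalJob J r w D h))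
    else
      ydsSpeed (J.filter fun j => r j < r (criticalJob J r w D h)) r w
        (r (criticalJob J r w D h)) t
  else 0
termination_by J.card
decreasing_by
  exact Finset.card_lt_card (Finset.filter_ssubset.2
    ⟨_, criticalJob_mem J r w D h, lt_irrefl _⟩)

/-- The total workload of the jobs that precede `i` when jobs are processed in the order of their
release times, ties being broken by `τ`. -/
noncomputable def workBefore (J : Finset ℕ) (r w : ℕ → ℝ) (τ : Equiv.Perm ℕ) (i : ℕ) : ℝ :=
  ∑ j ∈ J with r j < r i ∨ (r j = r i ∧ τ j < τ i), w j

/-- YDS runs job `i` at time `t`, when it always processes the unfinished released job with the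
earliest release time: the volume processed so far covers all jobs that precede `i`, but not `i`.
(As all deadlines agree, this is an earliest-deadline-first schedule.) -/
def ydsRuns (J : Finset ℕ) (r w : ℕ → ℝ) (D : ℝ) (τ : Equiv.Perm ℕ) (i : ℕ) (t : ℝ) : Prop :=
  workBefore J r w τ i ≤ (∫ x in Set.Iio t, ydsSpeed J r w D x) ∧
    (∫ x in Set.Iio t, ydsSpeed J r w D x) < workBefore J r w τ i + w i

/-! ### The online algorithm qOA for a common deadline -/

/-- The workload of the jobs of `J` released up to time `t` that qOA has not finished at time
`t < d`.  (A job released at `r j` is worked off at the relative rate `q / (d - t)`.) -/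
noncomputable def qoaPending (q : ℝ) (J : Finset ℕ) (r w : ℕ → ℝ) (d t : ℝ) : ℝ :=
  ∑ j ∈ J with r j ≤ t, w j * ((d - t) / (d - r j)) ^ q

/-- The speed of qOA: `q` times the speed `pending / (d - t)` at which an optimal offline schedule
would run the currently pending jobs, all of which are available and due at `d`. -/
noncomputable def qoaSpeed (q : ℝ) (J : Finset ℕ) (r w : ℕ → ℝ) (d t : ℝ) : ℝ :=
  if t < d then q * (qoaPending q J r w d t / (d - t)) else 0

/-- The share of one job in the speed of qOA integrates to the processed part of its workload. -/
theorem qoa_term (q a d t c : ℝ) (had : a < d) (ht : t < d) :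
    IntegrableOn (fun x => if a ≤ x then q * (c * ((d - x) / (d - a)) ^ q / (d - x)) else 0)
      (Set.Iic t) ∧
    ∫ x in Set.Iic t, (if a ≤ x then q * (c * ((d - x) / (d - a)) ^ q / (d - x)) else 0) =
      if a ≤ t then c - c * ((d - t) / (d - a)) ^ q else 0 := by
  set g : ℝ → ℝ := fun x => q * (c * ((d - x) / (d - a)) ^ q / (d - x)) with hg
  have hind : (fun x => if a ≤ x then q * (c * ((d - x) / (d - a)) ^ q / (d - x)) else 0)
      = (Set.Ici a).indicator g := by
    funext x
    simp only [Set.indicator_apply, Set.mem_Ici, hg]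
  rw [hind, integrableOn_indicator_iff measurableSet_Ici,
    setIntegral_indicator measurableSet_Ici, Set.inter_comm (Set.Ici a), Set.Iic_inter_Ici]
  by_cases hat : a ≤ t
  · have hda : 0 < d - a := by linarith
    have hcont : ContinuousOn g (Set.Icc a t) := by
      intro x hx
      have hx1 : d - x ≠ 0 := by have := hx.2; intro h; linarith
      have hx2 : (d - x) / (d - a) ≠ 0 := div_ne_zero hx1 hda.ne'
      apply ContinuousAt.continuousWithinAt
      refine continuousAt_const.mul (ContinuousAt.div (continuousAt_const.mul ?_) ?_ hx1)
      · exact ContinuousAt.rpow_const (by fun_prop) (Or.inl hx2)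
      · fun_prop
    refine ⟨hcont.integrableOn_Icc, ?_⟩
    rw [if_pos hat, integral_Icc_eq_integral_Ioc, ← intervalIntegral.integral_of_le hat]
    have hder : ∀ x ∈ Set.uIcc a t,
        HasDerivAt (fun x => -(c * ((d - x) / (d - a)) ^ q)) (g x) x := by
      intro x hx
      rw [Set.uIcc_of_le hat] at hx
      have hx0 : 0 < d - x := by have := hx.2; linarith
      have hx2 : 0 < (d - x) / (d - a) := div_pos hx0 hda
      have h1 : HasDerivAt (fun x => (d - x) / (d - a)) (-1 / (d - a)) x :=
        ((hasDerivAt_id x).const_sub d).div_const (d - a)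
      have h2 := ((h1.rpow_const (p := q) (Or.inl hx2.ne')).const_mul c).neg
      refine HasDerivAt.congr_deriv h2 ?_
      rw [Real.rpow_sub_one hx2.ne']
      simp only [hg]
      field_simp
    rw [intervalIntegral.integral_eq_sub_of_hasDerivAt hder
      ((by rw [Set.uIcc_of_le hat]; exact hcont : ContinuousOn g (Set.uIcc a t)).intervalIntegrable)]
    rw [div_self hda.ne', Real.one_rpow]
    ring
  · rw [if_neg hat, Set.Icc_eq_empty hat]
    simp

/-- `qoaPending` is what it should be: the released work minus the work that qOA has processed. -/
theorem qoaPending_eq (q : ℝ) (J : Finset ℕ) (r w : ℕ → ℝ) (d t : ℝ)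
    (hr : ∀ j ∈ J, r j < d) (ht : t < d) :
    IntegrableOn (qoaSpeed q J r w d) (Set.Iic t) ∧
    qoaPending q J r w d t =
      (∑ j ∈ J with r j ≤ t, w j) - ∫ x in Set.Iic t, qoaSpeed q J r w d x := by
  have heq : Set.EqOn (qoaSpeed q J r w d)
      (fun x => ∑ j ∈ J, if r j ≤ x then q * (w j * ((d - x) / (d - r j)) ^ q / (d - x)) else 0)
      (Set.Iic t) := by
    intro x hx
    have hx' : x < d := lt_of_le_of_lt hx ht
    simp only [qoaSpeed, qoaPending, if_pos hx', Finset.sum_div, Finset.mul_sum,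
      Finset.sum_filter]
    refine Finset.sum_congr rfl fun j _ => ?_
    split_ifs <;> ring
  have hint := fun j hj => (qoa_term q (r j) d t (w j) (hr j hj) ht)
  refine ⟨(integrableOn_congr_fun heq measurableSet_Iic).2
    (integrable_finsetSum J fun j hj => (hint j hj).1), ?_⟩
  rw [setIntegral_congr_fun measurableSet_Iic heq,
    integral_finsetSum J (fun j hj => (hint j hj).1),
    Finset.sum_congr rfl (fun j hj => (hint j hj).2), qoaPending, Finset.sum_filter,
    Finset.sum_filter, ← Finset.sum_sub_distrib]
  refine Finset.sum_congr rfl fun j _ => ?_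
  split_ifs <;> ring

/-! ### Common-deadline instances with predicted release times -/

/-- An instance with a common deadline `d`: the jobs `0, …, n - 1`, in the order of
their integral release times, their workloads, and a prediction `p i` of each release time. -/
structure Instance where
  n : ℕ
  d : ℝ
  release : ℕ → ℤ
  w : ℕ → ℝ
  p : ℕ → ℝ
  release_mono : ∀ i j, i ≤ j → j < n → release i ≤ release j
  release_lt : ∀ i < n, (release i : ℝ) < d
  w_nonneg : ∀ i < n, 0 ≤ w i
  p_lt : ∀ i < n, p i < d

namespace Instance

variable (I : Instance)

/-- The release times as real numbers. -/
def r (i : ℕ) : ℝ := I.release i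

/-- The prediction error of job `i`. -/
noncomputable def err (i : ℕ) : ℝ := |I.p i - I.r i| / (I.d - I.p i)

/-- The total prediction error `η = max_i η_i` (it is `0` if there are no jobs). -/
noncomputable def maxErr : ℝ := ⨆ i : Fin I.n, I.err i

/-- The shrunk prediction of the release time of job `i`. -/
noncomputable def shrunk (lam : ℝ) (i : ℕ) : ℝ := ⌊I.p i + lam * (I.d - I.p i)⌋

/-- The YDS schedule of the actual instance. -/
noncomputable def yds (t : ℝ) : ℝ := ydsSpeed (Finset.range I.n) I.r I.w I.d t

/-- The speed of qOA on the actual jobs `k, …, n - 1`. -/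
noncomputable def qoa (q : ℝ) (k : ℕ) (t : ℝ) : ℝ :=
  qoaSpeed q (Finset.Ico k I.n) I.r I.w I.d t

/-- Release times of the instance `J^i` formed at the release of job `i`: the merged job, which is
represented by `i`, is released now, every later job `j` at its shrunk prediction. -/
noncomputable def stepRelease (lam : ℝ) (i j : ℕ) : ℝ :=
  if j = i then I.r i else I.shrunk lam j

/-- Workloads of the instance `J^i`: the merged job has workload `u`. -/
noncomputable def stepWork (i : ℕ) (u : ℝ) (j : ℕ) : ℝ :=
  if j = i then u else I.w j

open Classical in
/-- The follow-the-prediction profile `FtP(i)` if the unfinished workload at `r i` of the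
jobs `0, …, i` is `u`: the YDS speed on `J^i` while YDS runs the merged job, and `0` otherwise. -/
noncomputable def profile (lam : ℝ) (τ : Equiv.Perm ℕ) (i : ℕ) (u t : ℝ) : ℝ :=
  if I.r i ≤ t ∧
      ydsRuns (Finset.Ico i I.n) (I.stepRelease lam i) (I.stepWork i u) I.d τ i t then
    ydsSpeed (Finset.Ico i I.n) (I.stepRelease lam i) (I.stepWork i u) I.d t
  else 0

/-- The unfinished workload of the jobs `0, …, i` at the release of job `i`, while the
algorithm follows the prediction; `τ i` breaks the ties in the YDS schedule of `J^i`. -/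
noncomputable def unfinished (lam : ℝ) (τ : ℕ → Equiv.Perm ℕ) : ℕ → ℝ
  | 0 => I.w 0
  | i + 1 => unfinished lam τ i
      - (∫ t in Set.Ico (I.r i) (I.r (i + 1)), I.profile lam (τ i) i (unfinished lam τ i) t)
      + I.w (i + 1)

/-- The first job whose prediction error exceeds `λ`, or `n` if there is none. -/
noncomputable def switch (lam : ℝ) : ℕ := sInf {i | I.n ≤ i ∨ lam < I.err i}

/-- The follow-the-prediction part of the speed: `FtP(i)` in `[r i, r (i + 1))`, except that
the last profile before a possible switch is kept until `d`. -/
noncomputable def ftpSpeed (lam : ℝ) (τ : ℕ → Equiv.Perm ℕ) (t : ℝ) : ℝ :=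
  ∑ i ∈ Finset.range (I.switch lam),
    if I.r i ≤ t ∧ t < (if i + 1 < I.switch lam then I.r (i + 1) else I.d) then
      I.profile lam (τ i) i (I.unfinished lam τ i) t
    else 0

/-- The speed of the algorithm CDSwP(λ): the follow-the-prediction speed, plus, in recovery
mode, the speed of qOA on the jobs that are released from the switch on. -/
noncomputable def cdswp (lam q : ℝ) (τ : ℕ → Equiv.Perm ℕ) (t : ℝ) : ℝ :=
  I.ftpSpeed lam τ t + I.qoa q (I.switch lam) t

end Instance

end SpeedScaling

/-! ### Tail workloads and the structure of YDS. -/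

namespace SpeedScaling

/-! With a common deadline `D`, feasibility is used only in the form "at least `tailWork` at `x` is
processed in `[x, D)`". The YDS speed `v` is a step function, nondecreasing up to `D`, whose steps
are the critical intervals. Summation by parts over these steps gives `∫ ψ(v) (g - v) ≥ 0` for a
competitor `g` and a monotone weight `ψ ≥ 0`; with the marginal cost `ψ(x) = α x ^ (α - 1)` and
convexity this is optimality of YDS (`yds_energy_le`). Truncating the weight at the level `v Z`
gives two one-sided versions: `yds_excess_energy_le` needs the tail inequalities of `g` only at
release times after `Z`, `yds_capped_energy_le` only at those up to `Z`.

Following the prediction: what remains of the YDS schedule of `J^i` after deleting the executed part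
is still feasible for `J^(i+1)`, since job `i + 1` is released no later than its shrunk prediction.
By optimality the energy spent so far plus that of the current plan never increases
(`follow_energy`), so it stays below the energy of YDS on `J^0`.

This alone does not suffice, because predictions from the switch `k` on may be arbitrarily bad. Let
`Z` be the largest release time in `J^0` among the jobs before `k`, and `v` the YDS speed on `J^0`.
The part of the last plan that is never executed still processes all jobs from `k` on, so it pays
for the excess of `v` over the level `v Z`; what was executed costs at most `∫ min(v, v Z) ^ α`. To
bound this, any schedule `s` of the actual instance is compressed towards `d` into `c * s (d - c *
(d - t))`, which costs `c ^ (α - 1)` times as much and meets the tail inequalities at release times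
up to `Z`: correctly predicted jobs satisfy `d - r i ≤ c * (d - p' i)`, and jobs from `k` on are
released after all of these. This is `follow_energy_le`, with `c = (1 + e) / (1 - λ)` for an error
bound `e`.

The first claim takes `e = η`. For the second, `e = λ`, the comparison schedule is qOA, and `(a + b)
^ α ≤ 2 ^ (α - 1) * (a ^ α + b ^ α)` adds the recovery speed, which is pointwise at most that of qOA
on all jobs. -/

/-- The total workload of the jobs of `J` that are released at or after `x`. -/
noncomputable def tailWork (J : Finset ℕ) (r w : ℕ → ℝ) (x : ℝ) : ℝ := ∑ j ∈ J with x ≤ r j, w j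

theorem tailWork_nonneg {J : Finset ℕ} {r w : ℕ → ℝ} (hw : ∀ j ∈ J, 0 ≤ w j) (x : ℝ) :
    0 ≤ tailWork J r w x :=
  Finset.sum_nonneg fun j hj => hw j (Finset.mem_filter.1 hj).1

theorem tailWork_filter_add {J : Finset ℕ} {r w : ℕ → ℝ} {x z : ℝ} (hxz : x ≤ z) :
    tailWork (J.filter (r · < z)) r w x + tailWork J r w z = tailWork J r w x := by
  unfold tailWork
  rw [Finset.filter_filter, Finset.sum_filter, Finset.sum_filter, Finset.sum_filter,
    ← Finset.sum_add_distrib]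
  refine Finset.sum_congr rfl fun j _ => ?_
  by_cases h : z ≤ r j
  · simp [h, not_lt.2 h, hxz.trans h]
  · simp [h, not_le.1 h]

theorem tailWork_eq_zero {J : Finset ℕ} {r w : ℕ → ℝ} {D x : ℝ} (hr : ∀ j ∈ J, r j < D)
    (hx : D ≤ x) : tailWork J r w x = 0 := by
  unfold tailWork
  rw [Finset.filter_false_of_mem, Finset.sum_empty]
  intro j hj
  have := hr j hj
  linarith

theorem ydsSpeed_empty (r w : ℕ → ℝ) (D : ℝ) : ydsSpeed ∅ r w D = 0 := by
  funext t
  rw [ydsSpeed]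
  simp

/-- Induction along the recursion of YDS: `[z, D)` is an interval of maximum density `ρ`. -/
theorem yds_induction (r w : ℕ → ℝ) {P : Finset ℕ → ℝ → Prop} (hempty : ∀ D, P ∅ D)
    (hstep : ∀ (J : Finset ℕ) (D z ρ : ℝ), (∀ j ∈ J, 0 ≤ w j) → (∀ j ∈ J, r j < D) → z < D →
      (∃ i ∈ J, r i = z) → 0 ≤ ρ → tailWork J r w z = ρ * (D - z) →
      (∀ x < D, tailWork J r w x ≤ ρ * (D - x)) →
      (∀ t, ydsSpeed J r w D t =
        if z ≤ t ∧ t < D then ρ else ydsSpeed (J.filter (r · < z)) r w z t) →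
      P (J.filter (r · < z)) z → P J D) :
    ∀ (J : Finset ℕ) (D : ℝ), (∀ j ∈ J, 0 ≤ w j) → (∀ j ∈ J, r j < D) → P J D := by
  intro J
  induction J using Finset.strongInduction with
  | H J ih =>
    intro D hw hr
    rcases J.eq_empty_or_nonempty with rfl | hJ
    · exact hempty D
    set i := criticalJob J r w D hJ with hi
    have hiJ : i ∈ J := criticalJob_mem J r w D hJ
    have hmax : ∀ j ∈ J, density J r w D (r j) ≤ density J r w D (r i) :=
      (J.exists_max_image (fun j => density J r w D (r j)) hJ).choose_spec.2
    have hiD : 0 < D - r i := sub_pos.2 (hr i hiJ)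
    have hρ : 0 ≤ density J r w D (r i) := div_nonneg (tailWork_nonneg hw _) hiD.le
    refine hstep J D (r i) (density J r w D (r i)) hw hr (hr i hiJ) ⟨i, hiJ, rfl⟩ hρ ?_ ?_ ?_ ?_
    · rw [density, div_mul_cancel₀ _ hiD.ne', tailWork]
    · intro x hx
      rcases (J.filter (x ≤ r ·)).eq_empty_or_nonempty with h | h
      · rw [tailWork, h, Finset.sum_empty]
        exact mul_nonneg hρ (sub_pos.2 hx).le
      · obtain ⟨j, hj, hjmin⟩ := Finset.exists_min_image _ r h
        rw [Finset.mem_filter] at hj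
        have hjD : 0 < D - r j := sub_pos.2 (hr j hj.1)
        have h1 : tailWork J r w x = tailWork J r w (r j) := by
          unfold tailWork
          congr 1
          ext l
          simp only [Finset.mem_filter]
          exact ⟨fun hl => ⟨hl.1, hjmin l (Finset.mem_filter.2 hl)⟩,
            fun hl => ⟨hl.1, hj.2.trans hl.2⟩⟩
        have h2 := hmax j hj.1
        rw [density, div_le_iff₀ hjD] at h2
        rw [h1]
        exact h2.trans (mul_le_mul_of_nonneg_left (by linarith [hj.2]) hρ)
    · intro t
      rw [ydsSpeed, dif_pos hJ]
    · refine ih (J.filter (r · < r i)) (Finset.filter_ssubset.2 ⟨i, hiJ, lt_irrefl _⟩) (r i) ?_ ?_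
      · exact fun j hj => hw j (Finset.mem_filter.1 hj).1
      · exact fun j hj => (Finset.mem_filter.1 hj).2

section Basic

variable {J : Finset ℕ} {r w : ℕ → ℝ} {D : ℝ} (hw : ∀ j ∈ J, 0 ≤ w j) (hr : ∀ j ∈ J, r j < D)
include hw hr

theorem ydsSpeed_nonneg (t : ℝ) : 0 ≤ ydsSpeed J r w D t := by
  revert t
  refine yds_induction r w (P := fun J D => ∀ t, 0 ≤ ydsSpeed J r w D t) ?_ ?_ J D hw hr
  · simp [ydsSpeed_empty]
  · intro J D z ρ _ _ _ _ hρ _ _ hv ih t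
    rw [hv]
    split_ifs
    exacts [hρ, ih t]

theorem ydsSpeed_eq_zero {t : ℝ} (ht : D ≤ t) : ydsSpeed J r w D t = 0 := by
  suffices h : ∀ t, D ≤ t → ydsSpeed J r w D t = 0 from h t ht
  clear ht t
  refine yds_induction r w (P := fun J D => ∀ t, D ≤ t → ydsSpeed J r w D t = 0) ?_ ?_ J D hw hr
  · simp [ydsSpeed_empty]
  · intro J D z ρ _ _ hz _ _ _ _ hv ih t ht
    rw [hv, if_neg (fun h => absurd h.2 (not_lt.2 ht)), ih t (hz.le.trans ht)]

/-- Removing a critical interval subtracts exactly `ρ * (D - z)` from every earlier tail, so a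
density bound survives the recursion. Applied with `M = ρ` to the remaining jobs, it shows that YDS
is never faster before its critical interval than in it. -/
theorem ydsSpeed_le {M : ℝ} (hM : 0 ≤ M) (h : ∀ x < D, tailWork J r w x ≤ M * (D - x)) (t : ℝ) :
    ydsSpeed J r w D t ≤ M := by
  revert t
  refine yds_induction r w (P := fun J D => (∀ x < D, tailWork J r w x ≤ M * (D - x)) →
    ∀ t, ydsSpeed J r w D t ≤ M) ?_ ?_ J D hw hr h
  · intro D _ t
    simpa [ydsSpeed_empty] using hM
  · intro J D z ρ _ _ hz _ hρ hz1 hx1 hv ih hM1 t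
    have hρM : ρ ≤ M := by
      have := hM1 z hz
      rw [hz1] at this
      exact le_of_mul_le_mul_right this (sub_pos.2 hz)
    rw [hv]
    split_ifs
    · exact hρM
    · refine ih (fun x hx => ?_) t
      have h1 := tailWork_filter_add (J := J) (r := r) (w := w) hx.le
      have h2 := hx1 x (hx.trans hz)
      have h3 : ρ * (z - x) ≤ M * (z - x) := mul_le_mul_of_nonneg_right hρM (sub_pos.2 hx).le
      linarith

end Basic

/-- The induction principle with the YDS speed as a sum of two functions with disjoint supports. -/
theorem yds_induction_add (r w : ℕ → ℝ) {P : Finset ℕ → ℝ → Prop} (hempty : ∀ D, P ∅ D)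
    (hstep : ∀ (J : Finset ℕ) (D z ρ : ℝ), (∀ j ∈ J, 0 ≤ w j) → (∀ j ∈ J, r j < D) → z < D →
      (∃ i ∈ J, r i = z) → 0 ≤ ρ → tailWork J r w z = ρ * (D - z) →
      (∀ x < D, tailWork J r w x ≤ ρ * (D - x)) →
      ydsSpeed J r w D =
        (Set.Ico z D).indicator (fun _ => ρ) + ydsSpeed (J.filter (r · < z)) r w z →
      (∀ t, z ≤ t → ydsSpeed (J.filter (r · < z)) r w z t = 0) →
      (∀ t, ydsSpeed (J.filter (r · < z)) r w z t ≤ ρ) →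
      P (J.filter (r · < z)) z → P J D)
    (J : Finset ℕ) (D : ℝ) (hw : ∀ j ∈ J, 0 ≤ w j) (hr : ∀ j ∈ J, r j < D) : P J D := by
  refine yds_induction r w hempty ?_ J D hw hr
  intro J D z ρ hw hr hz hi hρ hz1 hx1 hv ih
  have hw' : ∀ j ∈ J.filter (r · < z), 0 ≤ w j := fun j hj => hw j (Finset.mem_filter.1 hj).1
  have hr' : ∀ j ∈ J.filter (r · < z), r j < z := fun j hj => (Finset.mem_filter.1 hj).2
  refine hstep J D z ρ hw hr hz hi hρ hz1 hx1 ?_ (fun t ht => ydsSpeed_eq_zero hw' hr' ht)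
    (fun t => ydsSpeed_le hw' hr' hρ (fun x hx => ?_) t) ih
  · funext t
    rw [hv, Pi.add_apply]
    split_ifs with h
    · rw [Set.indicator_of_mem (Set.mem_Ico.2 h), ydsSpeed_eq_zero hw' hr' h.1, add_zero]
    · rw [Set.indicator_of_notMem (fun h' => h (Set.mem_Ico.1 h')), zero_add]
  · have h1 := tailWork_filter_add (J := J) (r := r) (w := w) hx.le
    have h2 := hx1 x (hx.trans hz)
    linarith

theorem setIntegral_Ici_indicator_Ico {z D ρ x : ℝ} (hz : z ≤ D) :
    ∫ t in Set.Ici x, (Set.Ico z D).indicator (fun _ => ρ) t =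
      ρ * (if x ≤ z then D - z else if x ≤ D then D - x else 0) := by
  rw [setIntegral_indicator measurableSet_Ico, setIntegral_const, smul_eq_mul, mul_comm]
  congr 1
  have : Set.Ici x ∩ Set.Ico z D = Set.Ico (max x z) D := by
    ext t; simp only [Set.mem_inter_iff, Set.mem_Ici, Set.mem_Ico, max_le_iff]; tauto
  rw [this, measureReal_def, Real.volume_Ico]
  split_ifs with h1 h2
  · rw [max_eq_right h1, ENNReal.toReal_ofReal (by linarith)]
  · rw [max_eq_left (by linarith), ENNReal.toReal_ofReal (by linarith)]
  · rw [max_eq_left (by linarith), ENNReal.ofReal_of_nonpos (by linarith), ENNReal.toReal_zero]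

section Work

variable {J : Finset ℕ} {r w : ℕ → ℝ} {D : ℝ} (hw : ∀ j ∈ J, 0 ≤ w j) (hr : ∀ j ∈ J, r j < D)
include hw hr

theorem measurable_ydsSpeed : Measurable (ydsSpeed J r w D) := by
  refine yds_induction_add r w (P := fun J D => Measurable (ydsSpeed J r w D)) ?_ ?_ J D hw hr
  · intro D
    rw [ydsSpeed_empty]
    exact measurable_const
  · intro J D z ρ _ _ _ _ _ _ _ hv _ _ ih
    rw [hv]
    exact (measurable_const.indicator measurableSet_Ico).add ih

theorem integrable_ydsSpeed : Integrable (ydsSpeed J r w D) := by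
  refine yds_induction_add r w (P := fun J D => Integrable (ydsSpeed J r w D)) ?_ ?_ J D hw hr
  · intro D
    rw [ydsSpeed_empty]
    exact integrable_zero _ _ _
  · intro J D z ρ _ _ _ _ _ _ _ hv _ _ ih
    rw [hv]
    exact ((integrableOn_const (by simp)).integrable_indicator measurableSet_Ico).add ih

theorem exists_ydsSpeed_le : ∃ M, 0 ≤ M ∧ ∀ t, ydsSpeed J r w D t ≤ M := by
  refine yds_induction_add r w (P := fun J D => ∃ M, 0 ≤ M ∧ ∀ t, ydsSpeed J r w D t ≤ M)
    ?_ ?_ J D hw hr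
  · intro D
    exact ⟨0, le_rfl, by simp [ydsSpeed_empty]⟩
  · intro J D z ρ _ _ _ _ hρ _ _ hv h0 hle _
    refine ⟨ρ, hρ, fun t => ?_⟩
    rw [hv, Pi.add_apply]
    by_cases ht : z ≤ t
    · rw [h0 t ht, add_zero]
      exact Set.indicator_le' (fun _ _ => le_rfl) (fun _ _ => hρ) t
    · rw [Set.indicator_of_notMem (fun h => ht h.1), zero_add]
      exact hle t

theorem exists_ydsSpeed_support : ∃ a < D, ∀ t < a, ydsSpeed J r w D t = 0 := by
  refine yds_induction_add r w (P := fun J D => ∃ a < D, ∀ t < a, ydsSpeed J r w D t = 0)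
    ?_ ?_ J D hw hr
  · intro D
    exact ⟨D - 1, by linarith, by simp [ydsSpeed_empty]⟩
  · rintro J D z ρ _ _ hz _ _ _ _ hv _ _ ⟨a, ha, h⟩
    refine ⟨a, ha.trans hz, fun t ht => ?_⟩
    rw [hv, Pi.add_apply, h t ht, Set.indicator_of_notMem (fun h => ?_), zero_add]
    linarith [h.1]

theorem ydsSpeed_eq_zero_of_lt {t : ℝ} (ht : ∀ j ∈ J, t < r j) : ydsSpeed J r w D t = 0 := by
  suffices h : ∀ t, (∀ j ∈ J, t < r j) → ydsSpeed J r w D t = 0 from h t ht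
  clear ht t
  refine yds_induction_add r w
    (P := fun J D => ∀ t, (∀ j ∈ J, t < r j) → ydsSpeed J r w D t = 0) ?_ ?_ J D hw hr
  · simp [ydsSpeed_empty]
  · rintro J D z ρ _ _ hz ⟨i, hi, rfl⟩ _ _ _ hv _ _ ih t ht
    rw [hv, Pi.add_apply, ih t fun j hj => ht j (Finset.mem_filter.1 hj).1,
      Set.indicator_of_notMem (fun h => ?_), zero_add]
    have := ht i hi
    linarith [h.1]

/-- Feasibility of YDS in tail form: inside the critical interval this is maximality of the density,
and before it the recursion applies. -/
theorem tailWork_le_integral_ydsSpeed (x : ℝ) :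
    tailWork J r w x ≤ ∫ t in Set.Ici x, ydsSpeed J r w D t := by
  revert x
  refine yds_induction_add r w (P := fun J D => (∀ j ∈ J, 0 ≤ w j) → (∀ j ∈ J, r j < D) →
    ∀ x, tailWork J r w x ≤ ∫ t in Set.Ici x, ydsSpeed J r w D t) ?_ ?_ J D hw hr hw hr
  · simp [ydsSpeed_empty, tailWork]
  · intro J D z ρ _ _ hz _ hρ hz1 hx1 hv h0 _ ih hw hr x
    have hw' : ∀ j ∈ J.filter (r · < z), 0 ≤ w j := fun j hj => hw j (Finset.mem_filter.1 hj).1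
    have hr' : ∀ j ∈ J.filter (r · < z), r j < z := fun j hj => (Finset.mem_filter.1 hj).2
    have hint := integrable_ydsSpeed hw' hr'
    rw [hv]
    simp only [Pi.add_apply]
    have hind : Integrable ((Set.Ico z D).indicator fun _ => ρ) :=
      (integrableOn_const (by simp)).integrable_indicator measurableSet_Ico
    rw [integral_add hind.integrableOn hint.integrableOn, setIntegral_Ici_indicator_Ico hz.le]
    have hnn : 0 ≤ ∫ t in Set.Ici x, ydsSpeed (J.filter (r · < z)) r w z t :=
      integral_nonneg fun t => ydsSpeed_nonneg hw' hr' t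
    split_ifs with h1 h2
    · have := ih hw' hr' x
      have := tailWork_filter_add (J := J) (r := r) (w := w) h1
      linarith
    · rcases h2.eq_or_lt with rfl | h2
      · rw [tailWork_eq_zero hr le_rfl]
        linarith
      · have := hx1 x h2
        linarith
    · rw [tailWork_eq_zero hr (not_le.1 h2).le]
      linarith

theorem integral_ydsSpeed : ∫ t, ydsSpeed J r w D t = ∑ j ∈ J, w j := by
  refine yds_induction_add r w (P := fun J D => (∀ j ∈ J, 0 ≤ w j) → (∀ j ∈ J, r j < D) →
    ∫ t, ydsSpeed J r w D t = ∑ j ∈ J, w j) ?_ ?_ J D hw hr hw hr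
  · simp [ydsSpeed_empty]
  · intro J D z ρ _ _ hz _ hρ hz1 hx1 hv h0 _ ih hw hr
    have hw' : ∀ j ∈ J.filter (r · < z), 0 ≤ w j := fun j hj => hw j (Finset.mem_filter.1 hj).1
    have hr' : ∀ j ∈ J.filter (r · < z), r j < z := fun j hj => (Finset.mem_filter.1 hj).2
    have hint := integrable_ydsSpeed hw' hr'
    rw [hv]
    simp only [Pi.add_apply]
    rw [integral_add ((integrableOn_const (by simp)).integrable_indicator measurableSet_Ico) hint,
      integral_indicator measurableSet_Ico, setIntegral_const, ih hw' hr', measureReal_def,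
      Real.volume_Ico, ENNReal.toReal_ofReal (sub_pos.2 hz).le, smul_eq_mul, mul_comm, ← hz1,
      ← Finset.sum_filter_add_sum_filter_not J (fun j => r j < z), tailWork, add_comm]
    simp only [not_lt]

end Work

/-! ### Duality for YDS -/

/-- Splitting `∫ ψ(v) (g - v)` at the start of a final interval of constant speed. -/
theorem dual_split {g v v' ψ : ℝ → ℝ} {z D ρ : ℝ} (hg : Integrable g) (hz : z < D)
    (hv : v = (Set.Ico z D).indicator (fun _ => ρ) + v') (h0 : ∀ t, z ≤ t → v' t = 0)
    (hI : IntegrableOn (fun t => ψ (v' t) * (g t - v' t)) (Set.Iio z)) :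
    IntegrableOn (fun t => ψ (v t) * (g t - v t)) (Set.Iio D) ∧
    ∫ t in Set.Iio D, ψ (v t) * (g t - v t) =
      (∫ t in Set.Iio z, ψ (v' t) * (g t - v' t)) +
        ψ ρ * ((∫ t in Set.Ico z D, g t) - ρ * (D - z)) := by
  have e1 : Set.EqOn (fun t => ψ (v t) * (g t - v t)) (fun t => ψ (v' t) * (g t - v' t))
      (Set.Iio z) := by
    intro t ht
    have : v t = v' t := by
      rw [hv, Pi.add_apply, Set.indicator_of_notMem (fun h => absurd h.1 (not_le.2 ht)), zero_add]
    simp only [this]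
  have e2 : Set.EqOn (fun t => ψ (v t) * (g t - v t)) (fun t => ψ ρ * (g t - ρ))
      (Set.Ico z D) := by
    intro t ht
    have : v t = ρ := by
      rw [hv, Pi.add_apply, Set.indicator_of_mem ht, h0 t ht.1, add_zero]
    simp only [this]
  have hc : IntegrableOn (fun _ : ℝ => ρ) (Set.Ico z D) := integrableOn_const (by simp)
  have i1 := (integrableOn_congr_fun e1 measurableSet_Iio).2 hI
  have i2 : IntegrableOn (fun t => ψ (v t) * (g t - v t)) (Set.Ico z D) :=
    (integrableOn_congr_fun e2 measurableSet_Ico).2 ((hg.integrableOn.sub hc).const_mul _)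
  have hU : Set.Iio D = Set.Iio z ∪ Set.Ico z D := (Set.Iio_union_Ico_eq_Iio hz.le).symm
  have hd : Disjoint (Set.Iio z) (Set.Ico z D) :=
    Set.disjoint_left.2 fun t h1 h2 => absurd h2.1 (not_le.2 h1)
  rw [hU]
  refine ⟨i1.union i2, ?_⟩
  rw [setIntegral_union hd measurableSet_Ico i1 i2, setIntegral_congr_fun measurableSet_Iio e1,
    setIntegral_congr_fun measurableSet_Ico e2, integral_const_mul,
    integral_sub hg.integrableOn hc, setIntegral_const, measureReal_def, Real.volume_Ico,
    ENNReal.toReal_ofReal (sub_pos.2 hz).le, smul_eq_mul, mul_comm ρ]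

theorem setIntegral_Ico_split {g : ℝ → ℝ} (hg : Integrable g) {x z D : ℝ} (h1 : x ≤ z)
    (h2 : z ≤ D) :
    ∫ t in Set.Ico x D, g t = (∫ t in Set.Ico x z, g t) + ∫ t in Set.Ico z D, g t := by
  rw [← Set.Ico_union_Ico_eq_Ico h1 h2, setIntegral_union
    (Set.disjoint_left.2 fun t h1 h2 => absurd h2.1 (not_le.2 h1.2)) measurableSet_Ico
    hg.integrableOn hg.integrableOn]

/-- If `g` processes the work released at or after each release time later than `Z` (up to a slack
`σ`), then so does YDS with the least weighted cost, for weights that are monotone in the speed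
and vanish up to the speed at time `Z`. -/
theorem yds_dual_of_lt {r w : ℕ → ℝ} {g ψ : ℝ → ℝ} (hg : Integrable g) (hψ : Monotone ψ)
    (hψ0 : ∀ x, 0 ≤ ψ x) {J : Finset ℕ} {D : ℝ} (hw : ∀ j ∈ J, 0 ≤ w j) (hr : ∀ j ∈ J, r j < D)
    {Z σ M : ℝ} (hZ : Z < D) (hσ : 0 ≤ σ) (hM : ∀ t, ydsSpeed J r w D t ≤ M)
    (hψZ : ψ (ydsSpeed J r w D Z) = 0)
    (hA : ∀ j ∈ J, Z < r j → tailWork J r w (r j) ≤ (∫ t in Set.Ico (r j) D, g t) + σ) :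
    IntegrableOn (fun t => ψ (ydsSpeed J r w D t) * (g t - ydsSpeed J r w D t)) (Set.Iio D) ∧
    -(σ * ψ M) ≤ ∫ t in Set.Iio D, ψ (ydsSpeed J r w D t) * (g t - ydsSpeed J r w D t) := by
  refine yds_induction_add r w (P := fun J D => ∀ σ M, Z < D → 0 ≤ σ →
    (∀ t, ydsSpeed J r w D t ≤ M) → ψ (ydsSpeed J r w D Z) = 0 →
    (∀ j ∈ J, Z < r j → tailWork J r w (r j) ≤ (∫ t in Set.Ico (r j) D, g t) + σ) →
    IntegrableOn (fun t => ψ (ydsSpeed J r w D t) * (g t - ydsSpeed J r w D t)) (Set.Iio D) ∧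
    -(σ * ψ M) ≤ ∫ t in Set.Iio D, ψ (ydsSpeed J r w D t) * (g t - ydsSpeed J r w D t))
    ?_ ?_ J D hw hr σ M hZ hσ hM hψZ hA
  · intro D σ M _ hσ _ h0 _
    simp only [ydsSpeed_empty, Pi.zero_apply] at h0
    simp only [ydsSpeed_empty, Pi.zero_apply, h0, zero_mul, integral_zero]
    exact ⟨integrableOn_zero, neg_nonpos.2 (mul_nonneg hσ (hψ0 M))⟩
  · rintro J D z ρ hw hr hz ⟨i, hi, rfl⟩ hρ hz1 _ hv h0 hle ih σ M hZ hσ hM hψZ hA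
    have hvz : ydsSpeed J r w D (r i) = ρ := by
      rw [hv, Pi.add_apply, Set.indicator_of_mem (Set.mem_Ico.2 ⟨le_rfl, hz⟩), h0 _ le_rfl, add_zero]
    have hvρ : ∀ t, ydsSpeed J r w D t ≤ ρ := by
      intro t
      rw [hv, Pi.add_apply]
      by_cases ht : r i ≤ t
      · rw [h0 t ht, add_zero]
        exact Set.indicator_le' (fun _ _ => le_rfl) (fun _ _ => hρ) t
      · rw [Set.indicator_of_notMem (fun h => ht h.1), zero_add]
        exact hle t
    -- If the critical interval contains `Z`, then `v Z` is the maximal speed and all weights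
    -- vanish.
    rcases le_or_gt (r i) Z with hiZ | hiZ
    · have hvZ : ydsSpeed J r w D Z = ρ := by
        rw [hv, Pi.add_apply, Set.indicator_of_mem (Set.mem_Ico.2 ⟨hiZ, hZ⟩), h0 _ hiZ, add_zero]
      have hz0 : ∀ t, ψ (ydsSpeed J r w D t) = 0 := fun t =>
        le_antisymm ((hψ (hvρ t)).trans (hvZ ▸ hψZ).le) (hψ0 _)
      simp only [hz0, zero_mul, integral_zero]
      exact ⟨integrableOn_zero, neg_nonpos.2 (mul_nonneg hσ (hψ0 M))⟩
    · have hδ := hA i hi hiZ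
      have hvZ : ydsSpeed J r w D Z = ydsSpeed (J.filter (r · < r i)) r w (r i) Z := by
        rw [hv, Pi.add_apply, Set.indicator_of_notMem (fun h => absurd h.1 (not_le.2 hiZ)),
          zero_add]
      -- The surplus of `g` on the critical interval becomes slack for the earlier ones; the
      -- inequality at `r i` makes the new slack nonnegative. Earlier speeds are at most `ρ`, so the
      -- new slack is charged at weight `ψ ρ`, the weight at which the surplus was earned.
      obtain ⟨hI, hb⟩ := ih (σ + ((∫ t in Set.Ico (r i) D, g t) - ρ * (D - r i))) ρ hiZ
        (by linarith) hle (hvZ ▸ hψZ) (by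
          intro j hj hjZ
          rw [Finset.mem_filter] at hj
          have h1 := hA j hj.1 hjZ
          rw [setIntegral_Ico_split hg hj.2.le hz.le,
            ← tailWork_filter_add hj.2.le] at h1
          linarith)
      obtain ⟨h1, h2⟩ := dual_split hg hz hv h0 hI
      refine ⟨h1, ?_⟩
      rw [h2]
      have hρM : σ * ψ ρ ≤ σ * ψ M := mul_le_mul_of_nonneg_left (hψ (hvz ▸ hM (r i))) hσ
      linarith

/-- The variant for a `g` that is only known to process the work released at or after the release
times up to `Z`, and weights that are constant from the speed at time `Z` on. -/
theorem yds_dual_of_le {r w : ℕ → ℝ} {g ψ : ℝ → ℝ} (hg : Integrable g) (hψ : Monotone ψ)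
    (hψ0 : ∀ x, 0 ≤ ψ x) (hψz : ψ 0 = 0) {J : Finset ℕ} {D : ℝ} (hw : ∀ j ∈ J, 0 ≤ w j)
    (hr : ∀ j ∈ J, r j < D) {Z : ℝ} (hZ : Z < D)
    (hψZ : ∀ x, ydsSpeed J r w D Z ≤ x → ψ x = ψ (ydsSpeed J r w D Z))
    (hA : ∀ j ∈ J, r j ≤ Z → tailWork J r w (r j) ≤ ∫ t in Set.Ico (r j) D, g t) :
    IntegrableOn (fun t => ψ (ydsSpeed J r w D t) * (g t - ydsSpeed J r w D t)) (Set.Iio D) ∧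
    0 ≤ ∫ t in Set.Iio D, ψ (ydsSpeed J r w D t) * (g t - ydsSpeed J r w D t) := by
  suffices h : ∀ σ, (∀ j ∈ J, r j ≤ Z → tailWork J r w (r j) ≤
      (∫ t in Set.Ico (r j) D, g t) + σ) →
      IntegrableOn (fun t => ψ (ydsSpeed J r w D t) * (g t - ydsSpeed J r w D t)) (Set.Iio D) ∧
      -(σ * ψ (ydsSpeed J r w D Z)) ≤
        ∫ t in Set.Iio D, ψ (ydsSpeed J r w D t) * (g t - ydsSpeed J r w D t) by
    simpa using h 0 (by simpa using hA)
  refine yds_induction_add r w (P := fun J D => Z < D →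
    (∀ x, ydsSpeed J r w D Z ≤ x → ψ x = ψ (ydsSpeed J r w D Z)) → ∀ σ,
    (∀ j ∈ J, r j ≤ Z → tailWork J r w (r j) ≤ (∫ t in Set.Ico (r j) D, g t) + σ) →
    IntegrableOn (fun t => ψ (ydsSpeed J r w D t) * (g t - ydsSpeed J r w D t)) (Set.Iio D) ∧
    -(σ * ψ (ydsSpeed J r w D Z)) ≤
      ∫ t in Set.Iio D, ψ (ydsSpeed J r w D t) * (g t - ydsSpeed J r w D t))
    ?_ ?_ J D hw hr hZ hψZ
  · intro D _ _ σ _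
    simp only [ydsSpeed_empty, Pi.zero_apply, hψz, zero_mul, integral_zero, mul_zero, neg_zero]
    exact ⟨integrableOn_zero, le_rfl⟩
  · rintro J D z ρ hw hr hz ⟨i, hi, rfl⟩ hρ hz1 _ hv h0 hle ih hZ hψZ σ hA
    have hw' : ∀ j ∈ J.filter (r · < r i), 0 ≤ w j := fun j hj => hw j (Finset.mem_filter.1 hj).1
    have hr' : ∀ j ∈ J.filter (r · < r i), r j < r i := fun j hj => (Finset.mem_filter.1 hj).2
    have hA' : ∀ j ∈ J.filter (r · < r i), r j ≤ Z →
        tailWork (J.filter (r · < r i)) r w (r j) ≤ (∫ t in Set.Ico (r j) (r i), g t) +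
          (σ + ((∫ t in Set.Ico (r i) D, g t) - ρ * (D - r i))) := by
      intro j hj hjZ
      rw [Finset.mem_filter] at hj
      have h1 := hA j hj.1 hjZ
      rw [setIntegral_Ico_split hg hj.2.le hz.le, ← tailWork_filter_add hj.2.le] at h1
      linarith
    rcases le_or_gt (r i) Z with hiZ | hiZ
    · have hδ := hA i hi hiZ
      have hvZ : ydsSpeed J r w D Z = ρ := by
        rw [hv, Pi.add_apply, Set.indicator_of_mem (Set.mem_Ico.2 ⟨hiZ, hZ⟩), h0 _ hiZ, add_zero]
      have hpre : ∃ Y < r i, ∀ j ∈ J.filter (r · < r i), Y < r j := by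
        obtain ⟨B, hB⟩ := ((J.filter (r · < r i)).image r).bddBelow
        refine ⟨min B (r i) - 1, by linarith [min_le_right B (r i)], fun j hj => ?_⟩
        have := hB (Finset.mem_coe.2 (Finset.mem_image_of_mem r hj))
        linarith [min_le_left B (r i)]
      obtain ⟨Y, hY, hYj⟩ := hpre
      -- All remaining release times are before `Z`, so every tail inequality is available; with `Y`
      -- before all of them the vanishing condition reduces to `ψ 0 = 0`.
      obtain ⟨hI, hb⟩ := yds_dual_of_lt (M := ρ) hg hψ hψ0 hw' hr' hY (by linarith) hle
        (by rw [ydsSpeed_eq_zero_of_lt hw' hr' hYj, hψz])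
        (fun j hj _ => hA' j hj ((Finset.mem_filter.1 hj).2.le.trans hiZ))
      obtain ⟨h1, h2⟩ := dual_split hg hz hv h0 hI
      refine ⟨h1, ?_⟩
      rw [h2, hvZ]
      linarith
    · have hvZ : ydsSpeed J r w D Z = ydsSpeed (J.filter (r · < r i)) r w (r i) Z := by
        rw [hv, Pi.add_apply, Set.indicator_of_notMem (fun h => absurd h.1 (not_le.2 hiZ)),
          zero_add]
      -- Nothing is known about `g` on this interval and the new slack may be negative, but the
      -- weight is the same on both sides, so the unknown surplus cancels.
      have hρZ : ψ ρ = ψ (ydsSpeed J r w D Z) := hψZ ρ (hvZ ▸ hle Z)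
      rw [hvZ] at hψZ
      obtain ⟨hI, hb⟩ := ih hiZ hψZ _ hA'
      obtain ⟨h1, h2⟩ := dual_split hg hz hv h0 hI
      refine ⟨h1, ?_⟩
      rw [h2, hρZ]
      rw [← hvZ] at hb
      linarith

/-! ### Energy inequalities for YDS -/

/-- Bernoulli's inequality for `y / x`, scaled by `x ^ α`. -/
theorem rpow_tangent_le {α x y : ℝ} (hα : 1 < α) (hx : 0 ≤ x) (hy : 0 ≤ y) :
    x ^ α + α * x ^ (α - 1) * (y - x) ≤ y ^ α := by
  rcases hx.eq_or_lt with rfl | hx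
  · rw [Real.zero_rpow (by linarith), Real.zero_rpow (by linarith)]
    simpa using Real.rpow_nonneg hy α
  · have h := one_add_mul_self_le_rpow_one_add (s := y / x - 1)
      (by linarith [div_nonneg hy hx.le]) hα.le
    rw [add_sub_cancel, Real.div_rpow hy hx.le, le_div_iff₀ (Real.rpow_pos_of_pos hx α)] at h
    refine le_trans (le_of_eq ?_) h
    rw [Real.rpow_sub_one hx.ne']
    field_simp

theorem integrable_rpow_of_le {α M : ℝ} {f : ℝ → ℝ} (hα : 1 < α) (hf : Integrable f)
    (hm : Measurable f) (h0 : ∀ t, 0 ≤ f t) (hM : ∀ t, f t ≤ M) :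
    Integrable fun t => f t ^ α := by
  refine (hf.const_mul (M ^ (α - 1))).mono' (hm.pow_const α).aestronglyMeasurable
    (Filter.Eventually.of_forall fun t => ?_)
  rw [Real.norm_of_nonneg (Real.rpow_nonneg (h0 t) α)]
  have h1 : f t ^ α = f t ^ (α - 1) * f t := by
    rw [← Real.rpow_add_one' (h0 t) (by linarith), sub_add_cancel]
  rw [h1]
  exact mul_le_mul_of_nonneg_right (Real.rpow_le_rpow (h0 t) (hM t) (by linarith)) (h0 t)

theorem exists_lt_forall_lt (J : Finset ℕ) (r : ℕ → ℝ) (D : ℝ) :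
    ∃ Y < D, ∀ j ∈ J, Y < r j := by
  obtain ⟨B, hB⟩ := (J.image r).bddBelow
  refine ⟨min B D - 1, by linarith [min_le_right B D], fun j hj => ?_⟩
  have := hB (Finset.mem_coe.2 (Finset.mem_image_of_mem r hj))
  linarith [min_le_left B D]

theorem monotone_marginal {α : ℝ} (hα : 1 < α) :
    Monotone fun x : ℝ => α * max x 0 ^ (α - 1) := fun x y hxy =>
  mul_le_mul_of_nonneg_left (Real.rpow_le_rpow (le_max_right _ _)
    (max_le_max_right 0 hxy) (by linarith)) (by linarith)

theorem marginal_nonneg {α : ℝ} (hα : 1 < α) (x : ℝ) : 0 ≤ α * max x 0 ^ (α - 1) :=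
  mul_nonneg (by linarith) (Real.rpow_nonneg (le_max_right _ _) _)

section Optimality

variable {J : Finset ℕ} {r w : ℕ → ℝ} {D α : ℝ} {g : ℝ → ℝ}

theorem integrable_ydsSpeed_rpow (hw : ∀ j ∈ J, 0 ≤ w j) (hr : ∀ j ∈ J, r j < D) (hα : 1 < α) :
    Integrable fun t => ydsSpeed J r w D t ^ α := by
  obtain ⟨M, _, hM⟩ := exists_ydsSpeed_le hw hr
  exact integrable_rpow_of_le hα (integrable_ydsSpeed hw hr) (measurable_ydsSpeed hw hr)
    (ydsSpeed_nonneg hw hr) hM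

theorem integrable_min_ydsSpeed_rpow (hw : ∀ j ∈ J, 0 ≤ w j) (hr : ∀ j ∈ J, r j < D)
    (hα : 1 < α) {c : ℝ} (hc : 0 ≤ c) :
    Integrable fun t => min (ydsSpeed J r w D t) c ^ α := by
  refine (integrable_ydsSpeed_rpow hw hr hα).mono'
    (((measurable_ydsSpeed hw hr).min measurable_const).pow_const α).aestronglyMeasurable
    (Filter.Eventually.of_forall fun t => ?_)
  have h0 := le_min (ydsSpeed_nonneg hw hr t) hc
  rw [Real.norm_of_nonneg (Real.rpow_nonneg h0 α)]
  exact Real.rpow_le_rpow h0 (min_le_left _ _) (by linarith)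

variable (hw : ∀ j ∈ J, 0 ≤ w j) (hr : ∀ j ∈ J, r j < D) (hα : 1 < α) (hg : Integrable g)
  (hg0 : ∀ t, 0 ≤ g t) (hgα : Integrable fun t => g t ^ α)
include hw hr hα hg hg0 hgα

/-- If `g` processes the work released at or after each release time later than `Z`, then its
energy is at least the excess of the energy of YDS over that of YDS capped at the speed at `Z`. -/
theorem yds_excess_energy_le {Z : ℝ} (hZ : Z < D)
    (hA : ∀ j ∈ J, Z < r j → tailWork J r w (r j) ≤ ∫ t in Set.Ico (r j) D, g t) :
    (∫ t, ydsSpeed J r w D t ^ α) ≤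
      (∫ t, g t ^ α) + ∫ t, min (ydsSpeed J r w D t) (ydsSpeed J r w D Z) ^ α := by
  have hv0 := ydsSpeed_nonneg hw hr
  obtain ⟨M, -, hM⟩ := exists_ydsSpeed_le hw hr
  set v := ydsSpeed J r w D with hv
  -- The marginal cost, switched off up to the level `v Z`; there the capped energy already equals
  -- that of `v`.
  let ψ : ℝ → ℝ := fun x => if v Z < x then α * max x 0 ^ (α - 1) else 0
  have hψ : Monotone ψ := by
    intro x y hxy
    simp only [ψ]
    split_ifs with h1 h2
    · exact monotone_marginal hα hxy
    · exact absurd (h1.trans_le hxy) h2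
    · exact marginal_nonneg hα y
    · exact le_rfl
  have hψ0 : ∀ x, 0 ≤ ψ x := by
    intro x
    simp only [ψ]
    split_ifs
    exacts [marginal_nonneg hα x, le_rfl]
  obtain ⟨hI, hb⟩ := yds_dual_of_lt (σ := 0) hg hψ hψ0 hw hr hZ le_rfl hM (by simp [ψ, hv])
    (by simpa using hA)
  rw [zero_mul, neg_zero] at hb
  have i1 := (integrable_ydsSpeed_rpow hw hr hα).integrableOn (s := Set.Iio D)
  have i2 := (integrable_min_ydsSpeed_rpow hw hr hα (hv0 Z)).integrableOn (s := Set.Iio D)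
  have i3 := hgα.integrableOn (s := Set.Iio D)
  have hmono : ∫ t in Set.Iio D, (v t ^ α + ψ (v t) * (g t - v t)) ≤
      ∫ t in Set.Iio D, (g t ^ α + min (v t) (v Z) ^ α) := by
    refine integral_mono (i1.add hI) (i3.add i2) fun t => ?_
    simp only [ψ]
    have hmin : 0 ≤ min (v t) (v Z) ^ α := Real.rpow_nonneg (le_min (hv0 t) (hv0 Z)) α
    split_ifs with h
    · rw [max_eq_left (hv0 t)]
      linarith [rpow_tangent_le hα (hv0 t) (hg0 t)]
    · rw [min_eq_left (not_lt.1 h)]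
      linarith [Real.rpow_nonneg (hg0 t) α]
  rw [integral_add i1 hI, integral_add i3 i2] at hmono
  have e1 : ∫ t in Set.Iio D, v t ^ α = ∫ t, v t ^ α :=
    setIntegral_eq_integral_of_forall_compl_eq_zero fun t ht => by
      rw [hv, ydsSpeed_eq_zero hw hr (not_lt.1 ht), Real.zero_rpow (by linarith)]
  have e2 : ∫ t in Set.Iio D, min (v t) (v Z) ^ α = ∫ t, min (v t) (v Z) ^ α :=
    setIntegral_eq_integral_of_forall_compl_eq_zero fun t ht => by
      rw [hv, ydsSpeed_eq_zero hw hr (not_lt.1 ht), min_eq_left (hv0 Z),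
        Real.zero_rpow (by linarith)]
  have e3 : ∫ t in Set.Iio D, g t ^ α ≤ ∫ t, g t ^ α :=
    setIntegral_le_integral hgα (Filter.Eventually.of_forall fun t => Real.rpow_nonneg (hg0 t) α)
  linarith

/-- If `g` processes the work released at or after each release time up to `Z`, then its energy is
at least that of YDS capped at the speed at `Z`. -/
theorem yds_capped_energy_le {Z : ℝ} (hZ : Z < D)
    (hA : ∀ j ∈ J, r j ≤ Z → tailWork J r w (r j) ≤ ∫ t in Set.Ico (r j) D, g t) :
    ∫ t, min (ydsSpeed J r w D t) (ydsSpeed J r w D Z) ^ α ≤ ∫ t, g t ^ α := by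
  have hv0 := ydsSpeed_nonneg hw hr
  set v := ydsSpeed J r w D with hv
  -- The marginal cost of the capped speed. The outer `max` only makes the weight monotone and
  -- nonnegative on negative arguments.
  let ψ : ℝ → ℝ := fun x => α * max (min x (v Z)) 0 ^ (α - 1)
  have hψ : Monotone ψ := fun x y hxy => monotone_marginal hα (min_le_min_right _ hxy)
  obtain ⟨hI, hb⟩ := yds_dual_of_le hg hψ (fun x => marginal_nonneg hα _)
    (by simp only [ψ]
        rw [min_eq_left (hv0 Z), max_self, Real.zero_rpow (by linarith), mul_zero]) hw hr hZ
    (fun x hx => by simp only [ψ]; rw [min_self, min_eq_right hx]) hA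
  have i2 := (integrable_min_ydsSpeed_rpow hw hr hα (hv0 Z)).integrableOn (s := Set.Iio D)
  have i3 := hgα.integrableOn (s := Set.Iio D)
  have hmono : ∫ t in Set.Iio D, (min (v t) (v Z) ^ α + ψ (v t) * (g t - v t)) ≤
      ∫ t in Set.Iio D, g t ^ α := by
    refine integral_mono (i2.add hI) i3 fun t => ?_
    have h0 := le_min (hv0 t) (hv0 Z)
    have h1 := rpow_tangent_le hα h0 (hg0 t)
    have h2 : ψ (v t) * (g t - v t) ≤ ψ (v t) * (g t - min (v t) (v Z)) :=
      mul_le_mul_of_nonneg_left (by linarith [min_le_left (v t) (v Z)]) (marginal_nonneg hα _)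
    simp only [ψ] at h2 ⊢
    rw [max_eq_left h0] at h2 ⊢
    linarith
  rw [integral_add i2 hI] at hmono
  have e2 : ∫ t in Set.Iio D, min (v t) (v Z) ^ α = ∫ t, min (v t) (v Z) ^ α :=
    setIntegral_eq_integral_of_forall_compl_eq_zero fun t ht => by
      rw [hv, ydsSpeed_eq_zero hw hr (not_lt.1 ht), min_eq_left (hv0 Z),
        Real.zero_rpow (by linarith)]
  have e3 : ∫ t in Set.Iio D, g t ^ α ≤ ∫ t, g t ^ α :=
    setIntegral_le_integral hgα (Filter.Eventually.of_forall fun t => Real.rpow_nonneg (hg0 t) α)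
  linarith

/-- Optimality of YDS. -/
theorem yds_energy_le (hA : ∀ j ∈ J, tailWork J r w (r j) ≤ ∫ t in Set.Ico (r j) D, g t) :
    ∫ t, ydsSpeed J r w D t ^ α ≤ ∫ t, g t ^ α := by
  obtain ⟨Y, hY, hYj⟩ := exists_lt_forall_lt J r D
  have h := yds_excess_energy_le hw hr hα hg hg0 hgα hY fun j hj _ => hA j hj
  have h0 : ∀ t, min (ydsSpeed J r w D t) (ydsSpeed J r w D Y) ^ α = 0 := fun t => by
    rw [ydsSpeed_eq_zero_of_lt hw hr hYj, min_eq_right (ydsSpeed_nonneg hw hr t),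
      Real.zero_rpow (by linarith)]
  simpa [h0] using h

end Optimality

/-! ### The share of one job in a schedule that runs jobs in a fixed order -/

/-- The volume processed by a speed profile before time `t`. -/
noncomputable def processed (v : ℝ → ℝ) (t : ℝ) : ℝ := ∫ x in Set.Iio t, v x

section Share

variable {v : ℝ → ℝ} (hv : Integrable v)
include hv

omit hv in
theorem disjoint_Iio_Ici (x : ℝ) : Disjoint (Set.Iio x) (Set.Ici x) :=
  Set.Iio_disjoint_Ici le_rfl

theorem setIntegral_Ico_eq_sub {x y : ℝ} (hxy : x ≤ y) :
    ∫ t in Set.Ico x y, v t = processed v y - processed v x := by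
  rw [processed, processed, ← Set.Iio_union_Ico_eq_Iio hxy, setIntegral_union
    ((disjoint_Iio_Ici x).mono_right Set.Ico_subset_Ici_self) measurableSet_Ico
    hv.integrableOn hv.integrableOn, add_sub_cancel_left]

theorem processed_add_Ici (x : ℝ) :
    processed v x + ∫ t in Set.Ici x, v t = ∫ t, v t := by
  rw [processed, ← setIntegral_union (disjoint_Iio_Ici x) measurableSet_Ici hv.integrableOn hv.integrableOn, Set.Iio_union_Ici, setIntegral_univ]

theorem continuous_processed : Continuous (processed v) := by
  have h : processed v = fun x => processed v 0 + ∫ t in (0 : ℝ)..x, v t := by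
    funext x
    rw [processed, processed, ← integral_Iic_eq_integral_Iio, ← integral_Iic_eq_integral_Iio,
      ← intervalIntegral.integral_Iic_sub_Iic hv.integrableOn hv.integrableOn, add_sub_cancel]
  rw [h]
  exact continuous_const.add (intervalIntegral.continuous_primitive
    (fun _ _ => hv.intervalIntegrable) 0)

variable (hv0 : ∀ t, 0 ≤ v t)
include hv0

theorem monotone_processed : Monotone (processed v) := fun _ _ hxy =>
  setIntegral_mono_set hv.integrableOn (Filter.Eventually.of_forall hv0)
    (Set.Iio_subset_Iio hxy).eventuallyLE

theorem measurableSet_processed_lt (m : ℝ) : MeasurableSet {x | processed v x < m} :=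
  (monotone_processed hv hv0).measurable measurableSet_Iio

variable {a : ℝ} (ha : ∀ t < a, v t = 0)
include ha

/-- The processed volume is continuous and monotone, so for `0 < m` reached by time `t` the set
where it is below `m` is a half-line ending at the first time when it equals `m`. The vanishing of
`v` before `a` makes that first time exist. -/
theorem integral_processed_lt {m : ℝ} (hm : 0 ≤ m) (t : ℝ) :
    processed ({x | processed v x < m}.indicator v) t = min (processed v t) m := by
  have hmono := monotone_processed hv hv0
  have hF0 : ∀ x, 0 ≤ processed v x := fun x => integral_nonneg hv0
  have hFa : ∀ x ≤ a, processed v x = 0 := fun x hx => by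
    rw [processed, setIntegral_congr_fun (g := fun _ => (0 : ℝ)) measurableSet_Iio
      (fun y hy => ha y (lt_of_lt_of_le hy hx)), integral_zero]
  rcases lt_or_ge (processed v t) m with h | h
  · rw [min_eq_left h.le, processed, processed]
    refine setIntegral_congr_fun measurableSet_Iio fun x hx => ?_
    exact Set.indicator_of_mem (s := {x | processed v x < m})
      (lt_of_le_of_lt (hmono (le_of_lt hx)) h) v
  · rw [min_eq_right h]
    rcases hm.eq_or_lt with rfl | hm
    · have : {x | processed v x < 0} = ∅ := by
        ext x; simpa using hF0 x
      rw [this, Set.indicator_empty]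
      simp [processed]
    · have hat : a ≤ t := by
        by_contra hta
        rw [hFa t (not_le.1 hta).le] at h
        linarith
      have hcpt : IsCompact (Set.Icc a t ∩ {x | processed v x = m}) :=
        isCompact_Icc.inter_right (isClosed_eq (continuous_processed hv) continuous_const)
      have hne : (Set.Icc a t ∩ {x | processed v x = m}).Nonempty := by
        obtain ⟨x, hx, hxm⟩ := intermediate_value_Icc hat (continuous_processed hv).continuousOn
          (show m ∈ Set.Icc (processed v a) (processed v t) from ⟨by rw [hFa a le_rfl]; exact hm.le, h⟩)
        exact ⟨x, hx, hxm⟩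
      obtain ⟨s, ⟨⟨has, hst⟩, hsm⟩, hmin⟩ := hcpt.exists_isLeast hne
      have hset : {x | processed v x < m} = Set.Iio s := by
        ext x
        simp only [Set.mem_ofPred_eq, Set.mem_Iio]
        refine ⟨fun hx => ?_, fun hx => ?_⟩
        · by_contra hsx
          have := hmono (not_lt.1 hsx)
          rw [hsm] at this
          linarith
        · refine lt_of_le_of_ne (hsm ▸ hmono hx.le) fun hxm => ?_
          rcases lt_or_ge x a with hxa | hxa
          · rw [hFa x hxa.le] at hxm
            linarith
          · exact absurd (hmin ⟨⟨hxa, hx.le.trans hst⟩, hxm⟩) (not_le.2 hx)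
      rw [hset, processed, setIntegral_indicator measurableSet_Iio, Set.Iio_inter_Iio,
        min_eq_right hst]
      exact hsm

/-- A job that occupies the volume levels `[l, l + u)` and is released at a time `b` at which at
most the volume `l` has been processed. -/
theorem processed_share {b l u : ℝ} (hl : 0 ≤ l) (hu : 0 ≤ u) (hb : processed v b ≤ l) (t : ℝ) :
    processed ({x | b ≤ x ∧ l ≤ processed v x ∧ processed v x < l + u}.indicator v) t =
      min (processed v t) (l + u) - min (processed v t) l := by
  have hmono := monotone_processed hv hv0
  have hm := measurableSet_processed_lt hv hv0
  have heq : ∀ x, b ≤ x →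
      {x | b ≤ x ∧ l ≤ processed v x ∧ processed v x < l + u}.indicator v x =
      {x | processed v x < l + u}.indicator v x - {x | processed v x < l}.indicator v x := by
    intro x hx
    simp only [Set.indicator_apply, Set.mem_ofPred_eq]
    by_cases h1 : processed v x < l
    · simp [h1, not_le.2 h1, show processed v x < l + u by linarith]
    · simp [h1, hx, not_lt.1 h1]
  have hlow : ∀ y ≤ b, min (processed v y) (l + u) - min (processed v y) l = 0 := by
    intro y hy
    have := (hmono hy).trans hb
    rw [min_eq_left this, min_eq_left (by linarith), sub_self]
  have hzero : ∀ y ≤ b, processed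
      ({x | b ≤ x ∧ l ≤ processed v x ∧ processed v x < l + u}.indicator v) y = 0 := by
    intro y hy
    rw [processed, setIntegral_congr_fun (g := fun _ => (0 : ℝ)) measurableSet_Iio
      (fun x hx => Set.indicator_of_notMem (fun h => ?_) v), integral_zero]
    exact absurd (hx.trans_le hy) (not_lt.2 h.1)
  rcases le_or_gt t b with h | h
  · rw [hlow t h, hzero t h]
  · have hset : MeasurableSet {x | b ≤ x ∧ l ≤ processed v x ∧ processed v x < l + u} :=
      measurableSet_Ici.inter ((hmono.measurable measurableSet_Ici).inter (hm _))
    have h1 := setIntegral_Ico_eq_sub (hv.indicator hset) h.le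
    have i1 := hv.indicator (hm (l + u))
    have i2 := hv.indicator (hm l)
    rw [hzero b le_rfl, sub_zero, setIntegral_congr_fun measurableSet_Ico (fun x hx => heq x hx.1),
      integral_sub i1.integrableOn i2.integrableOn, setIntegral_Ico_eq_sub i1 h.le,
      setIntegral_Ico_eq_sub i2 h.le] at h1
    simp only [integral_processed_lt hv hv0 ha hl,
      integral_processed_lt hv hv0 ha (add_nonneg hl hu)] at h1
    have := hlow b le_rfl
    linarith

end Share

section FirstReleased

variable {J : Finset ℕ} {r w : ℕ → ℝ} {D : ℝ} (hw : ∀ j ∈ J, 0 ≤ w j) (hr : ∀ j ∈ J, r j < D)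
  (τ : Equiv.Perm ℕ) {i : ℕ}

/-- The part of the workload of job `i` that YDS has processed before time `t`. -/
noncomputable def ydsShare (J : Finset ℕ) (r w : ℕ → ℝ) (D : ℝ) (τ : Equiv.Perm ℕ) (i : ℕ)
    (t : ℝ) : ℝ :=
  min (processed (ydsSpeed J r w D) t) (workBefore J r w τ i + w i) -
    min (processed (ydsSpeed J r w D) t) (workBefore J r w τ i)

include hw

theorem workBefore_nonneg : 0 ≤ workBefore J r w τ i :=
  Finset.sum_nonneg fun j hj => hw j (Finset.mem_filter.1 hj).1

include hr

/-- At least the tail workload of `r i` is processed from `r i` on, so by conservation of volume at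
most the work released strictly earlier is processed before. YDS thus does not reach job `i` before
its release, whatever the tie-breaking. -/
theorem processed_release_le : processed (ydsSpeed J r w D) (r i) ≤ workBefore J r w τ i := by
  have h1 := processed_add_Ici (integrable_ydsSpeed hw hr) (r i)
  have h2 := tailWork_le_integral_ydsSpeed hw hr (r i)
  rw [integral_ydsSpeed hw hr, ← Finset.sum_filter_add_sum_filter_not J (fun j => r i ≤ r j)] at h1
  have h3 : ∑ j ∈ J with ¬ r i ≤ r j, w j ≤ workBefore J r w τ i := by
    refine Finset.sum_le_sum_of_subset_of_nonneg (fun j hj => ?_)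
      fun j hj _ => hw j (Finset.mem_filter.1 hj).1
    simp only [Finset.mem_filter, not_le] at hj ⊢
    exact ⟨hj.1, Or.inl hj.2⟩
  unfold tailWork at h2
  linarith

theorem ydsShare_of_le {x : ℝ} (hx : x ≤ r i) (hi : i ∈ J) : ydsShare J r w D τ i x = 0 := by
  have h1 := (monotone_processed (integrable_ydsSpeed hw hr) (ydsSpeed_nonneg hw hr) hx).trans
    (processed_release_le hw hr τ)
  rw [ydsShare, min_eq_left h1, min_eq_left (by linarith [hw i hi]), sub_self]

omit hr in
theorem ydsShare_le (hi : i ∈ J) (x : ℝ) : ydsShare J r w D τ i x ≤ w i := by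
  have := hw i hi
  rw [ydsShare]
  rcases le_total (processed (ydsSpeed J r w D) x) (workBefore J r w τ i) with h | h
  · rw [min_eq_left h]
    linarith [min_le_left (processed (ydsSpeed J r w D) x) (workBefore J r w τ i + w i)]
  · rw [min_eq_right h]
    linarith [min_le_right (processed (ydsSpeed J r w D) x) (workBefore J r w τ i + w i)]

/-- After time `x` YDS processes the rest of job `i` and all the other jobs released after `x`. -/
theorem rest_add_le_integral_ydsSpeed (hi : i ∈ J) (x : ℝ) :
    w i - ydsShare J r w D τ i x + tailWork (J.erase i) r w x ≤
      ∫ t in Set.Ici x, ydsSpeed J r w D t := by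
  have hG := tailWork_le_integral_ydsSpeed hw hr x
  have hwi := hw i hi
  have hA : tailWork (J.erase i) r w x + (if x ≤ r i then w i else 0) = tailWork J r w x := by
    unfold tailWork
    rw [Finset.sum_filter, Finset.sum_filter, Finset.sum_erase_add _ _ hi]
  rcases le_or_gt x (r i) with h | h
  · rw [if_pos h] at hA
    rw [ydsShare_of_le hw hr τ h hi]
    linarith
  · rw [if_neg (not_le.2 h)] at hA
    -- As `r i < x`, no job is counted twice among the predecessors of `i`, `i` itself and the jobs
    -- released at or after `x`.
    have hsum : workBefore J r w τ i + w i + tailWork (J.erase i) r w x ≤ ∑ j ∈ J, w j := by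
      have e1 : w i = ∑ j ∈ J, if j = i then w j else 0 := by
        rw [Finset.sum_ite_eq' J i w, if_pos hi]
      rw [add_zero] at hA
      rw [hA]
      unfold workBefore tailWork
      rw [e1, Finset.sum_filter, Finset.sum_filter, ← Finset.sum_add_distrib,
        ← Finset.sum_add_distrib]
      refine Finset.sum_le_sum fun j hj => ?_
      have := hw j hj
      by_cases h1 : j = i
      · subst h1
        simp [not_le.2 h]
      · by_cases h2 : x ≤ r j
        · have h3 : ¬ r j < r i := by linarith
          have h4 : ¬ r j = r i := by intro h5; linarith
          simp [h1, h2, h3, h4]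
        · simp only [h1, h2, if_false, add_zero]
          split_ifs
          exacts [le_rfl, this]
    have htot := processed_add_Ici (integrable_ydsSpeed hw hr) x
    rw [integral_ydsSpeed hw hr] at htot
    rw [ydsShare]
    set F := processed (ydsSpeed J r w D) x
    set l := workBefore J r w τ i
    rcases le_total F (l + w i) with hF | hF
    · rw [min_eq_left hF]
      linarith [min_le_right F l]
    · rw [min_eq_right hF, min_eq_right (by linarith)]
      linarith

end FirstReleased

/-- The times before `e` at which YDS runs job `i`. -/
def ydsTimes (J : Finset ℕ) (r w : ℕ → ℝ) (D : ℝ) (τ : Equiv.Perm ℕ) (i : ℕ) (e : ℝ) : Set ℝ :=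
  {t | (r i ≤ t ∧ ydsRuns J r w D τ i t) ∧ t < e}

section Parts

variable {J : Finset ℕ} {r w : ℕ → ℝ} {D : ℝ} (hw : ∀ j ∈ J, 0 ≤ w j) (hr : ∀ j ∈ J, r j < D)
  (τ : Equiv.Perm ℕ) {i : ℕ}
include hw hr

theorem measurableSet_ydsTimes (e : ℝ) : MeasurableSet (ydsTimes J r w D τ i e) := by
  have hmono := monotone_processed (integrable_ydsSpeed hw hr) (ydsSpeed_nonneg hw hr)
  exact (measurableSet_Ici.inter ((hmono.measurable measurableSet_Ici).inter
    (measurableSet_processed_lt (integrable_ydsSpeed hw hr) (ydsSpeed_nonneg hw hr) _))).inter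
    measurableSet_Iio

theorem processed_ydsTimes (hi : i ∈ J) {t e : ℝ} (hte : t ≤ e) :
    processed ((ydsTimes J r w D τ i e).indicator (ydsSpeed J r w D)) t =
      ydsShare J r w D τ i t := by
  obtain ⟨a, -, ha⟩ := exists_ydsSpeed_support hw hr
  have h := processed_share (integrable_ydsSpeed hw hr) (ydsSpeed_nonneg hw hr) ha
    (workBefore_nonneg hw τ) (hw i hi) (processed_release_le hw hr τ (i := i)) t
  rw [ydsShare, ← h, processed, processed]
  refine setIntegral_congr_fun measurableSet_Iio fun x hx => ?_
  exact Set.indicator_eq_indicator ⟨fun h => h.1, fun h => ⟨h, lt_of_lt_of_le hx hte⟩⟩ rfl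

theorem setIntegral_ydsTimes (hi : i ∈ J) {x e : ℝ} (hxe : x ≤ e) :
    ∫ t in Set.Ico x e, (ydsTimes J r w D τ i e).indicator (ydsSpeed J r w D) t =
      ydsShare J r w D τ i e - ydsShare J r w D τ i x := by
  rw [setIntegral_Ico_eq_sub ((integrable_ydsSpeed hw hr).indicator
    (measurableSet_ydsTimes hw hr τ e)) hxe, processed_ydsTimes hw hr τ hi le_rfl,
    processed_ydsTimes hw hr τ hi hxe]

theorem integrable_indicator_ydsSpeed_rpow {α : ℝ} (hα : 1 < α) {S : Set ℝ}
    (hS : MeasurableSet S) : Integrable fun t => S.indicator (ydsSpeed J r w D) t ^ α := by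
  obtain ⟨M, hM0, hM⟩ := exists_ydsSpeed_le hw hr
  exact integrable_rpow_of_le hα ((integrable_ydsSpeed hw hr).indicator hS)
    ((measurable_ydsSpeed hw hr).indicator hS)
    (fun t => Set.indicator_nonneg (fun t _ => ydsSpeed_nonneg hw hr t) t)
    (fun t => Set.indicator_le' (fun t _ => hM t) (fun _ _ => hM0) t)

theorem energy_indicator_add_compl {α : ℝ} (hα : 1 < α) {S : Set ℝ} (hS : MeasurableSet S) :
    (∫ t, S.indicator (ydsSpeed J r w D) t ^ α) + ∫ t, Sᶜ.indicator (ydsSpeed J r w D) t ^ α =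
      ∫ t, ydsSpeed J r w D t ^ α := by
  rw [← integral_add (integrable_indicator_ydsSpeed_rpow hw hr hα hS)
    (integrable_indicator_ydsSpeed_rpow hw hr hα hS.compl)]
  refine integral_congr_ae (Filter.Eventually.of_forall fun t => ?_)
  have h0 : (0 : ℝ) ^ α = 0 := Real.zero_rpow (by linarith)
  by_cases h : t ∈ S
  · simp [h, h0]
  · simp [h, h0]

/-- If job `i` is stopped at time `e`, then the rest of the YDS schedule still processes all
other jobs, and leaves enough capacity for the unfinished part of job `i`. -/
theorem tailWork_erase_add_le (hi : i ∈ J) {x e : ℝ} (he : e ≤ D) :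
    (if x ≤ e then w i - ydsShare J r w D τ i e else 0) + tailWork (J.erase i) r w x ≤
      ∫ t in Set.Ico x D, (ydsTimes J r w D τ i e)ᶜ.indicator (ydsSpeed J r w D) t := by
  have hint := integrable_ydsSpeed hw hr
  have hS := measurableSet_ydsTimes hw hr τ e (i := i)
  have h1 := rest_add_le_integral_ydsSpeed hw hr τ hi x
  have h2 : ∫ t in Set.Ici x, ydsSpeed J r w D t = ∫ t in Set.Ico x D, ydsSpeed J r w D t := by
    refine setIntegral_eq_of_subset_of_forall_sdiff_eq_zero measurableSet_Ici
      Set.Ico_subset_Ici_self fun t ht => ydsSpeed_eq_zero hw hr ?_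
    by_contra h
    exact ht.2 ⟨ht.1, not_le.1 h⟩
  have h3 : ∫ t in Set.Ico x D, (ydsTimes J r w D τ i e)ᶜ.indicator (ydsSpeed J r w D) t =
      (∫ t in Set.Ico x D, ydsSpeed J r w D t) -
        ∫ t in Set.Ico x D, (ydsTimes J r w D τ i e).indicator (ydsSpeed J r w D) t := by
    rw [← integral_sub hint.integrableOn (hint.indicator hS).integrableOn, Set.indicator_compl]
    rfl
  have h4 : ∫ t in Set.Ico x D, (ydsTimes J r w D τ i e).indicator (ydsSpeed J r w D) t =
      ∫ t in Set.Ico x e, (ydsTimes J r w D τ i e).indicator (ydsSpeed J r w D) t := by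
    refine setIntegral_eq_of_subset_of_forall_sdiff_eq_zero measurableSet_Ico
      (Set.Ico_subset_Ico_right he) fun t ht => Set.indicator_of_notMem (fun h => ?_) _
    exact ht.2 ⟨ht.1.1, h.2⟩
  rw [h3, h4, ← h2]
  split_ifs with hxe
  · rw [setIntegral_ydsTimes hw hr τ hi hxe]
    linarith
  · rw [Set.Ico_eq_empty (fun h => hxe h.le), setIntegral_empty]
    linarith [ydsShare_le (r := r) (D := D) hw τ hi x]

end Parts

/-! ### Stretching a schedule towards the deadline -/

theorem integral_comp_stretch (f : ℝ → ℝ) {c : ℝ} (hc : 0 < c) (d : ℝ) :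
    ∫ t, f (d - c * (d - t)) = c⁻¹ * ∫ t, f t := by
  have h := Measure.integral_comp_mul_left (fun x => f (x + (d - c * d))) c
  rw [integral_add_right_eq_self f, abs_of_pos (inv_pos.2 hc), smul_eq_mul] at h
  rw [← h]
  congr 1
  funext t
  congr 1
  ring

theorem integrable_comp_stretch {f : ℝ → ℝ} (hf : Integrable f) {c : ℝ} (hc : 0 < c) (d : ℝ) :
    Integrable fun t => f (d - c * (d - t)) := by
  have h := (hf.comp_add_right (d - c * d)).comp_mul_left' hc.ne'
  refine h.congr (Filter.Eventually.of_forall fun t => ?_)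
  simp only
  congr 1
  ring

/-- Compression towards `d` preserves volumes and divides the distances to `d` by `c`. -/
theorem setIntegral_stretch (f : ℝ → ℝ) {c : ℝ} (hc : 0 < c) (d x : ℝ) :
    ∫ t in Set.Ico x d, c * f (d - c * (d - t)) = ∫ t in Set.Ico (d - c * (d - x)) d, f t := by
  rw [integral_const_mul, ← integral_indicator measurableSet_Ico,
    ← integral_indicator measurableSet_Ico]
  have h := integral_comp_stretch ((Set.Ico (d - c * (d - x)) d).indicator f) hc d
  have heq : (Set.Ico x d).indicator (fun t => f (d - c * (d - t))) =
      fun t => (Set.Ico (d - c * (d - x)) d).indicator f (d - c * (d - t)) := by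
    funext t
    have hiff : d - c * (d - t) ∈ Set.Ico (d - c * (d - x)) d ↔ t ∈ Set.Ico x d := by
      simp only [Set.mem_Ico]
      constructor
      · rintro ⟨h1, h2⟩
        constructor
        · have : c * (d - t) ≤ c * (d - x) := by linarith
          linarith [le_of_mul_le_mul_left this hc]
        · have : 0 < c * (d - t) := by linarith
          linarith [pos_of_mul_pos_right this hc.le]
      · rintro ⟨h1, h2⟩
        constructor
        · linarith [mul_le_mul_of_nonneg_left (by linarith : d - t ≤ d - x) hc.le]
        · linarith [mul_pos hc (sub_pos.2 h2)]
    by_cases ht : t ∈ Set.Ico x d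
    · rw [Set.indicator_of_mem ht, Set.indicator_of_mem (hiff.2 ht)]
    · rw [Set.indicator_of_notMem ht, Set.indicator_of_notMem (mt hiff.1 ht)]
  rw [heq, h, mul_inv_cancel_left₀ hc.ne']

end SpeedScaling

/-! ### The follow-the-prediction phase. -/

namespace SpeedScaling
namespace Instance

variable (I : Instance)

/-- The speed of the YDS schedule that is computed at the release of job `i`. -/
noncomputable def stepSpeed (lam : ℝ) (τ : ℕ → Equiv.Perm ℕ) (i : ℕ) : ℝ → ℝ :=
  ydsSpeed (Finset.Ico i I.n) (I.stepRelease lam i) (I.stepWork i (I.unfinished lam τ i)) I.d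

/-- The times before `e` at which `FtP(i)` runs the merged job. -/
def stepTimes (lam : ℝ) (τ : ℕ → Equiv.Perm ℕ) (i : ℕ) (e : ℝ) : Set ℝ :=
  ydsTimes (Finset.Ico i I.n) (I.stepRelease lam i) (I.stepWork i (I.unfinished lam τ i)) I.d
    (τ i) i e

/-- The time at which the profile `FtP(i)` is replaced, if `k` is the switch. -/
noncomputable def stepEnd (k i : ℕ) : ℝ := if i + 1 < k then I.r (i + 1) else I.d

theorem profile_eq (lam : ℝ) (τ : ℕ → Equiv.Perm ℕ) (i : ℕ) (e t : ℝ) :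
    (if I.r i ≤ t ∧ t < e then I.profile lam (τ i) i (I.unfinished lam τ i) t else 0) =
      (I.stepTimes lam τ i e).indicator (I.stepSpeed lam τ i) t := by
  classical
  have hri : I.stepRelease lam i i = I.r i := if_pos rfl
  rw [profile, Set.indicator_apply, stepTimes, ydsTimes, hri, stepSpeed]
  simp only [Set.mem_ofPred_eq]
  by_cases h1 : I.r i ≤ t <;> by_cases h2 : t < e <;> simp [h1, h2]

theorem ftpSpeed_eq (lam : ℝ) (τ : ℕ → Equiv.Perm ℕ) (t : ℝ) :
    I.ftpSpeed lam τ t = ∑ i ∈ Finset.range (I.switch lam),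
      (I.stepTimes lam τ i (I.stepEnd (I.switch lam) i)).indicator (I.stepSpeed lam τ i) t :=
  Finset.sum_congr rfl fun i _ => I.profile_eq lam τ i (I.stepEnd (I.switch lam) i) t

variable {I}

theorem shrunk_lt {lam : ℝ} (hlam : lam < 1) {j : ℕ} (hj : j < I.n) : I.shrunk lam j < I.d := by
  have h := I.p_lt j hj
  refine (Int.floor_le _).trans_lt ?_
  nlinarith

theorem stepRelease_lt {lam : ℝ} (hlam : lam < 1) (i : ℕ) :
    ∀ j ∈ Finset.Ico i I.n, I.stepRelease lam i j < I.d := by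
  intro j hj
  rw [Finset.mem_Ico] at hj
  rw [stepRelease]
  split_ifs with h
  · exact I.release_lt i (h ▸ hj.2)
  · exact shrunk_lt hlam hj.2

theorem stepWork_nonneg {i : ℕ} {u : ℝ} (hu : 0 ≤ u) :
    ∀ j ∈ Finset.Ico i I.n, 0 ≤ I.stepWork i u j := by
  intro j hj
  rw [Finset.mem_Ico] at hj
  rw [stepWork]
  split_ifs with h
  · exact hu
  · exact I.w_nonneg j hj.2

theorem r_mono {i j : ℕ} (hij : i ≤ j) (hj : j < I.n) : I.r i ≤ I.r j :=
  Int.cast_le.2 (I.release_mono i j hij hj)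

theorem Ico_erase_left {i n : ℕ} : (Finset.Ico i n).erase i = Finset.Ico (i + 1) n := by
  ext j
  simp only [Finset.mem_erase, Finset.mem_Ico]
  omega

theorem tailWork_erase_step (lam : ℝ) (i : ℕ) (u x : ℝ) :
    tailWork ((Finset.Ico i I.n).erase i) (I.stepRelease lam i) (I.stepWork i u) x =
      tailWork (Finset.Ico (i + 1) I.n) (I.shrunk lam) I.w x := by
  unfold tailWork
  rw [Ico_erase_left, Finset.sum_filter, Finset.sum_filter]
  refine Finset.sum_congr rfl fun j hj => ?_
  have h : j ≠ i := by
    rw [Finset.mem_Ico] at hj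
    omega
  rw [stepRelease, stepWork, if_neg h, if_neg h]

theorem tailWork_step (lam : ℝ) {i : ℕ} (hi : i < I.n) (u x : ℝ) :
    tailWork (Finset.Ico i I.n) (I.stepRelease lam i) (I.stepWork i u) x =
      (if x ≤ I.r i then u else 0) + tailWork (Finset.Ico (i + 1) I.n) (I.shrunk lam) I.w x := by
  rw [← tailWork_erase_step lam i u]
  unfold tailWork
  rw [Finset.sum_filter, Finset.sum_filter,
    ← Finset.add_sum_erase _ _ (Finset.mem_Ico.2 ⟨le_rfl, hi⟩)]
  simp only [stepRelease, stepWork, if_true]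

theorem tailWork_shrunk_step (lam : ℝ) {i : ℕ} (hi : i < I.n) (x : ℝ) :
    tailWork (Finset.Ico i I.n) (I.shrunk lam) I.w x =
      (if x ≤ I.shrunk lam i then I.w i else 0) +
        tailWork (Finset.Ico (i + 1) I.n) (I.shrunk lam) I.w x := by
  unfold tailWork
  rw [← Ico_erase_left, Finset.sum_filter, Finset.sum_filter,
    ← Finset.add_sum_erase _ _ (Finset.mem_Ico.2 ⟨le_rfl, hi⟩)]

section Follow

variable {lam α : ℝ} (hlam : lam < 1) (hα : 1 < α) (τ : ℕ → Equiv.Perm ℕ) {k : ℕ} (hk : k ≤ I.n)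
  (hpred : ∀ i < k, I.r i ≤ I.shrunk lam i)
include hlam hk hpred

/-- One step of the algorithm: the unfinished workload is nonnegative, and the rest of the YDS
schedule processes the next instance. -/
theorem follow_step {i : ℕ} (hi : i + 1 < k) (hu : 0 ≤ I.unfinished lam τ i) :
    0 ≤ I.unfinished lam τ (i + 1) ∧
    ∀ x, tailWork (Finset.Ico (i + 1) I.n) (I.stepRelease lam (i + 1))
        (I.stepWork (i + 1) (I.unfinished lam τ (i + 1))) x ≤
      ∫ t in Set.Ico x I.d,
        (I.stepTimes lam τ i (I.r (i + 1)))ᶜ.indicator (I.stepSpeed lam τ i) t := by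
  have hin : i < I.n := by omega
  have hmem : i ∈ Finset.Ico i I.n := Finset.mem_Ico.2 ⟨le_rfl, hin⟩
  have hw := stepWork_nonneg (I := I) (i := i) hu
  have hr := stepRelease_lt (I := I) hlam i
  have hri : I.stepRelease lam i i = I.r i := if_pos rfl
  have hui : I.stepWork i (I.unfinished lam τ i) i = I.unfinished lam τ i := if_pos rfl
  have hle : I.r i ≤ I.r (i + 1) := r_mono (Nat.le_succ i) (by omega)
  have hint : ∫ t in Set.Ico (I.r i) (I.r (i + 1)),
      I.profile lam (τ i) i (I.unfinished lam τ i) t =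
      ydsShare (Finset.Ico i I.n) (I.stepRelease lam i) (I.stepWork i (I.unfinished lam τ i)) I.d
        (τ i) i (I.r (i + 1)) := by
    have h := setIntegral_ydsTimes hw hr (τ i) hmem hle
    rw [ydsShare_of_le hw hr (τ i) hri.ge hmem, sub_zero] at h
    rw [← h]
    refine setIntegral_congr_fun measurableSet_Ico fun t ht => ?_
    have := I.profile_eq lam τ i (I.r (i + 1)) t
    rw [if_pos (Set.mem_Ico.1 ht)] at this
    exact this
  have hun : I.unfinished lam τ (i + 1) = I.unfinished lam τ i -
      ydsShare (Finset.Ico i I.n) (I.stepRelease lam i) (I.stepWork i (I.unfinished lam τ i)) I.d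
        (τ i) i (I.r (i + 1)) + I.w (i + 1) := by
    rw [← hint]
    rfl
  have hsh := ydsShare_le (D := I.d) (r := I.stepRelease lam i) hw (τ i) hmem (I.r (i + 1))
  rw [hui] at hsh
  have hwi := I.w_nonneg (i + 1) (by omega)
  refine ⟨by linarith, fun x => ?_⟩
  have hd : I.r (i + 1) ≤ I.d := (I.release_lt (i + 1) (by omega)).le
  have h := tailWork_erase_add_le hw hr (τ i) hmem (x := x) hd
  rw [hui, tailWork_erase_step, tailWork_shrunk_step lam (by omega : i + 1 < I.n)] at h
  rw [tailWork_step lam (by omega : i + 1 < I.n)]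
  refine le_trans ?_ h
  -- The real release is no later than the shrunk prediction, so moving job `i + 1` to it only
  -- weakens the tail inequalities.
  have hp := hpred (i + 1) hi
  split_ifs with h1 h2 h2
  · linarith
  · linarith
  · linarith
  · linarith

include hα

/-- A potential argument: the energy already spent plus that of the current full plan does not
increase, since the unexecuted part of the old plan competes with the new optimum. -/
theorem follow_energy (i : ℕ) (hi : i < k) :
    0 ≤ I.unfinished lam τ i ∧
    (∑ l ∈ Finset.range i, ∫ t,
      (I.stepTimes lam τ l (I.r (l + 1))).indicator (I.stepSpeed lam τ l) t ^ α) +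
        ∫ t, I.stepSpeed lam τ i t ^ α ≤ ∫ t, I.stepSpeed lam τ 0 t ^ α := by
  induction i with
  | zero => exact ⟨I.w_nonneg 0 (by omega), by simp⟩
  | succ i ih =>
    obtain ⟨hu, hE⟩ := ih (by omega)
    obtain ⟨hu', hA⟩ := follow_step hlam τ hk hpred hi hu
    refine ⟨hu', le_trans ?_ hE⟩
    have hw := stepWork_nonneg (I := I) (i := i) hu
    have hr := stepRelease_lt (I := I) hlam i
    have hS := measurableSet_ydsTimes hw hr (τ i) (I.r (i + 1)) (i := i)
    have hopt := yds_energy_le (stepWork_nonneg hu') (stepRelease_lt hlam (i + 1)) hα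
      ((integrable_ydsSpeed hw hr).indicator hS.compl)
      (fun t => Set.indicator_nonneg (fun t _ => ydsSpeed_nonneg hw hr t) t)
      (integrable_indicator_ydsSpeed_rpow hw hr hα hS.compl) (fun j _ => hA _)
    have hsplit := energy_indicator_add_compl hw hr hα hS
    rw [Finset.sum_range_succ]
    simp only [stepSpeed, stepTimes] at hopt hsplit ⊢
    linarith

/-- The energy of the follow-the-prediction phase is at most `c ^ (α - 1)` times the energy of any
speed profile that processes the work released at or after each time. -/
theorem follow_energy_le {c : ℝ} (hc : 1 ≤ c)
    (hcr : ∀ i < k, I.d - I.r i ≤ c * (I.d - I.shrunk lam i)) {s : ℝ → ℝ} (hs : Integrable s)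
    (hs0 : ∀ t, 0 ≤ s t) (hsα : Integrable fun t => s t ^ α)
    (hA : ∀ y, tailWork (Finset.range I.n) I.r I.w y ≤ ∫ t in Set.Ico y I.d, s t) :
    ∑ i ∈ Finset.range k, ∫ t,
      (I.stepTimes lam τ i (I.stepEnd k i)).indicator (I.stepSpeed lam τ i) t ^ α ≤
        c ^ (α - 1) * ∫ t, s t ^ α := by
  have hc0 : 0 < c := by linarith
  rcases k with _ | m
  · simpa using mul_nonneg (Real.rpow_nonneg hc0.le _)
      (integral_nonneg fun t => Real.rpow_nonneg (hs0 t) α)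
  have hmn : m < I.n := hk
  obtain ⟨hum, hEm⟩ := follow_energy hlam hα τ hk hpred m (Nat.lt_succ_self m)
  have hu0 : 0 ≤ I.unfinished lam τ 0 := I.w_nonneg 0 (by omega)
  have hwm := stepWork_nonneg (I := I) (i := m) hum
  have hrm := stepRelease_lt (I := I) hlam m
  have hw := stepWork_nonneg (I := I) (i := 0) hu0
  have hr := stepRelease_lt (I := I) hlam 0
  have hS := measurableSet_ydsTimes hwm hrm (τ m) I.d (i := m)
  have hsplit := energy_indicator_add_compl hwm hrm hα hS
  have hsum : ∑ i ∈ Finset.range (m + 1), ∫ t,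
      (I.stepTimes lam τ i (I.stepEnd (m + 1) i)).indicator (I.stepSpeed lam τ i) t ^ α =
      (∑ i ∈ Finset.range m, ∫ t,
        (I.stepTimes lam τ i (I.r (i + 1))).indicator (I.stepSpeed lam τ i) t ^ α) +
      ∫ t, (I.stepTimes lam τ m I.d).indicator (I.stepSpeed lam τ m) t ^ α := by
    rw [Finset.sum_range_succ]
    congr 1
    · refine Finset.sum_congr rfl fun i hi => ?_
      rw [stepEnd, if_pos (by have := Finset.mem_range.1 hi; omega)]
    · rw [stepEnd, if_neg (by omega)]
  -- The release time of `b` in `J^0` serves as `Z`: only jobs from the switch on have later release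
  -- times in `J^0`.
  obtain ⟨b, hb, hbmax⟩ := Finset.exists_max_image (Finset.range (m + 1)) (I.stepRelease lam 0)
    ⟨0, Finset.mem_range.2 (by omega)⟩
  rw [Finset.mem_range] at hb
  have hbmax' : ∀ i < m + 1, I.stepRelease lam 0 i ≤ I.stepRelease lam 0 b :=
    fun i hi => hbmax i (Finset.mem_range.2 hi)
  have hZ : I.stepRelease lam 0 b < I.d := hr b (Finset.mem_Ico.2 ⟨by omega, by omega⟩)
  have hstep : ∀ i < m + 1, I.r i ≤ I.stepRelease lam 0 i ∧
      I.d - I.r i ≤ c * (I.d - I.stepRelease lam 0 i) := by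
    intro i hi
    rw [stepRelease]
    split_ifs with h
    · subst h
      have := I.release_lt 0 (by omega)
      refine ⟨le_rfl, ?_⟩
      simp only [Instance.r]
      nlinarith
    · exact ⟨hpred i hi, hcr i hi⟩
  -- The unexecuted part of the last plan contains all jobs from the switch on, at the same shrunk
  -- predictions as in `J^0`.
  have hrest := yds_excess_energy_le hw hr hα ((integrable_ydsSpeed hwm hrm).indicator hS.compl)
    (fun t => Set.indicator_nonneg (fun t _ => ydsSpeed_nonneg hwm hrm t) t)
    (integrable_indicator_ydsSpeed_rpow hwm hrm hα hS.compl) hZ (by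
      intro j hj hjZ
      have hxd := hr j hj
      set x := I.stepRelease lam 0 j
      have h := tailWork_erase_add_le hwm hrm (τ m) (Finset.mem_Ico.2 ⟨le_rfl, hmn⟩) (x := x)
        (le_refl I.d)
      rw [if_pos hxd.le, tailWork_erase_step] at h
      have hsh := ydsShare_le (D := I.d) (r := I.stepRelease lam m) hwm (τ m)
        (Finset.mem_Ico.2 ⟨le_rfl, hmn⟩) I.d
      have heq : tailWork (Finset.Ico 0 I.n) (I.stepRelease lam 0)
          (I.stepWork 0 (I.unfinished lam τ 0)) x =
          tailWork (Finset.Ico (m + 1) I.n) (I.shrunk lam) I.w x := by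
        unfold tailWork
        have hset : (Finset.Ico 0 I.n).filter (x ≤ I.stepRelease lam 0 ·) =
            (Finset.Ico (m + 1) I.n).filter (x ≤ I.shrunk lam ·) := by
          ext l
          simp only [Finset.mem_filter, Finset.mem_Ico]
          constructor
          · rintro ⟨⟨_, hl⟩, hxl⟩
            have hml : m + 1 ≤ l := by
              by_contra hml
              exact absurd (hbmax' l (by omega)) (not_le.2 (hjZ.trans_le hxl))
            rw [stepRelease, if_neg (by omega)] at hxl
            exact ⟨⟨hml, hl⟩, hxl⟩
          · rintro ⟨⟨hml, hl⟩, hxl⟩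
            rw [stepRelease, if_neg (by omega)]
            exact ⟨⟨by omega, hl⟩, hxl⟩
        rw [hset]
        refine Finset.sum_congr rfl fun l hl => ?_
        have := (Finset.mem_Ico.1 (Finset.mem_filter.1 hl).1).1
        rw [stepWork, if_neg (by omega)]
      rw [heq]
      linarith)
  have hgα : (fun t => (c * s (I.d - c * (I.d - t))) ^ α) =
      fun t => c ^ α * (fun y => s y ^ α) (I.d - c * (I.d - t)) := by
    funext t
    rw [Real.mul_rpow hc0.le (hs0 _)]
  -- The competitor is `s` compressed by the factor `c`. It suffices that each job counted at `x ≤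
  -- Z` in `J^0` is really released at or after `d - c * (d - x)`.
  have hcap := yds_capped_energy_le hw hr hα
    (g := fun t => c * s (I.d - c * (I.d - t)))
    ((integrable_comp_stretch hs hc0 I.d).const_mul c) (fun t => mul_nonneg hc0.le (hs0 _))
    (by rw [hgα]; exact (integrable_comp_stretch hsα hc0 I.d).const_mul _) hZ (by
      intro j hj hjZ
      rw [setIntegral_stretch s hc0]
      refine le_trans ?_ (hA _)
      set x := I.stepRelease lam 0 j
      have hxb : c * (I.d - I.stepRelease lam 0 b) ≤ c * (I.d - x) :=
        mul_le_mul_of_nonneg_left (by linarith) hc0.le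
      unfold tailWork
      have hwork : ∀ l, I.stepWork 0 (I.unfinished lam τ 0) l = I.w l := by
        intro l
        rw [stepWork]
        split_ifs with h
        · rw [h]
          rfl
        · rfl
      simp only [hwork]
      refine Finset.sum_le_sum_of_subset_of_nonneg (fun l hl => ?_) fun l hl _ =>
        I.w_nonneg l (Finset.mem_range.1 (Finset.mem_filter.1 hl).1)
      simp only [Finset.mem_filter, Finset.mem_Ico, Finset.mem_range] at hl ⊢
      refine ⟨hl.1.2, ?_⟩
      rcases lt_or_ge l (m + 1) with hlm | hlm
      · have h1 := (hstep l hlm).2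
        have h2 : c * (I.d - I.stepRelease lam 0 l) ≤ c * (I.d - x) :=
          mul_le_mul_of_nonneg_left (by linarith [hl.2]) hc0.le
        linarith
      -- For a job from the switch on its own prediction is useless; its release is bounded below by
      -- that of `b`, and `x ≤ Z`.
      · have h1 := (hstep b hb).2
        have h2 : I.r b ≤ I.r l := r_mono (by omega) hl.1.2
        linarith)
  rw [hgα, integral_const_mul, integral_comp_stretch (fun y => s y ^ α) hc0, ← mul_assoc,
    ← Real.rpow_neg_one c, ← Real.rpow_add hc0, ← sub_eq_add_neg] at hcap
  rw [hsum]
  simp only [stepSpeed, stepTimes] at hEm hsplit hrest hcap ⊢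
  linarith

end Follow

end Instance
-- Elementary facts on extended-real energies.
theorem energy_eq_ofReal {α : ℝ} {s : ℝ → ℝ} (hs0 : ∀ t, 0 ≤ s t)
    (hs : Integrable fun t => s t ^ α) : energy α s = ENNReal.ofReal (∫ t, s t ^ α) :=
  (ofReal_integral_eq_lintegral_ofReal hs
    (Filter.Eventually.of_forall fun t => Real.rpow_nonneg (hs0 t) α)).symm

theorem energy_mono {α : ℝ} (hα : 1 < α) {s s' : ℝ → ℝ} (hs0 : ∀ t, 0 ≤ s t)
    (h : ∀ t, s t ≤ s' t) : energy α s ≤ energy α s' :=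
  lintegral_mono fun t =>
    ENNReal.ofReal_le_ofReal (Real.rpow_le_rpow (hs0 t) (h t) (by linarith))

theorem energy_add_le {α : ℝ} (hα : 1 < α) {s s' : ℝ → ℝ} (hs0 : ∀ t, 0 ≤ s t)
    (hs0' : ∀ t, 0 ≤ s' t) (hm : Measurable s') :
    energy α (fun t => s t + s' t) ≤
      ENNReal.ofReal (2 ^ (α - 1)) * (energy α s + energy α s') := by
  unfold energy
  rw [← lintegral_add_right _ (hm.pow_const α).ennreal_ofReal,
    ← lintegral_const_mul' _ _ ENNReal.ofReal_ne_top]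
  refine lintegral_mono fun t => ?_
  rw [← ENNReal.ofReal_rpow_of_nonneg (add_nonneg (hs0 t) (hs0' t)) (by linarith),
    ← ENNReal.ofReal_rpow_of_nonneg (hs0 t) (by linarith),
    ← ENNReal.ofReal_rpow_of_nonneg (hs0' t) (by linarith),
    ENNReal.ofReal_add (hs0 t) (hs0' t), ← ENNReal.ofReal_rpow_of_pos (by norm_num),
    ENNReal.ofReal_ofNat]
  exact ENNReal.rpow_add_le_mul_rpow_add_rpow _ _ hα.le

/-! ### The speed of qOA -/

section QOA

variable {J : Finset ℕ} {r w : ℕ → ℝ} {d q : ℝ}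

theorem measurable_qoaSpeed : Measurable (qoaSpeed q J r w d) := by
  unfold qoaSpeed qoaPending
  simp only [Finset.sum_filter]
  refine Measurable.ite measurableSet_Iio (measurable_const.mul (Measurable.div ?_ ?_))
    measurable_const
  · refine Finset.measurable_fun_sum _ fun j _ => Measurable.ite measurableSet_Ici ?_
      measurable_const
    exact measurable_const.mul
      (((measurable_const.sub measurable_id).div measurable_const).pow_const q)
  · exact measurable_const.sub measurable_id

variable (hq : 1 ≤ q) (hw : ∀ j ∈ J, 0 ≤ w j) (hr : ∀ j ∈ J, r j < d)
include hq hw hr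

theorem qoaSpeed_mono {J' : Finset ℕ} (hJ : J' ⊆ J) (t : ℝ) :
    qoaSpeed q J' r w d t ≤ qoaSpeed q J r w d t := by
  unfold qoaSpeed
  split_ifs with ht
  · refine mul_le_mul_of_nonneg_left (div_le_div_of_nonneg_right ?_ (sub_pos.2 ht).le)
      (by linarith)
    refine Finset.sum_le_sum_of_subset_of_nonneg (Finset.filter_subset_filter _ hJ)
      fun j hj _ => ?_
    have hj := (Finset.mem_filter.1 hj).1
    exact mul_nonneg (hw j hj) (Real.rpow_nonneg
      (div_nonneg (sub_pos.2 ht).le (sub_pos.2 (hr j hj)).le) q)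
  · exact le_rfl

theorem qoaSpeed_nonneg (t : ℝ) : 0 ≤ qoaSpeed q J r w d t := by
  have h := qoaSpeed_mono hq hw hr (Finset.empty_subset J) t
  simpa [qoaSpeed, qoaPending] using h

/-- qOA finishes all jobs. -/
theorem tailWork_le_lintegral_qoaSpeed (y : ℝ) :
    ENNReal.ofReal (tailWork J r w y) ≤
      ∫⁻ t in Set.Ico y d, ENNReal.ofReal (qoaSpeed q J r w d t) := by
  -- Run alone, the jobs released from `y` on never make qOA faster, and this run is idle before
  -- `y`.
  set J' := J.filter (y ≤ r ·) with hJ'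
  have hJ : J' ⊆ J := Finset.filter_subset _ _
  have hw' : ∀ j ∈ J', 0 ≤ w j := fun j hj => hw j (hJ hj)
  have hr' : ∀ j ∈ J', r j < d := fun j hj => hr j (hJ hj)
  let f : ℝ → ℝ := fun t => ∑ j ∈ J', (w j - w j * ((d - t) / (d - r j)) ^ q)
  have hf : Filter.Tendsto f (nhdsWithin d (Set.Iio d)) (nhds (tailWork J r w y)) := by
    have hc : ContinuousAt f d := by
      refine tendsto_finsetSum _ fun j _ => ?_
      refine ContinuousAt.sub continuousAt_const (continuousAt_const.mul ?_)
      exact ContinuousAt.rpow_const (by fun_prop) (Or.inr (by linarith))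
    have hfd : f d = tailWork J r w y := by
      simp only [f, sub_self, zero_div]
      rw [Real.zero_rpow (by linarith)]
      simp [tailWork, hJ']
    rw [← hfd]
    exact hc.mono_left nhdsWithin_le_nhds
  -- The work processed by time `t < d` is known exactly; all work is completed only in the limit `t
  -- → d`.
  refine le_of_tendsto (ENNReal.tendsto_ofReal hf) ?_
  have hev : ∀ᶠ t in nhdsWithin d (Set.Iio d), ∀ j ∈ J', r j ≤ t :=
    (Finset.eventually_all J').2 fun j hj =>
      nhdsWithin_le_nhds ((eventually_gt_nhds (hr' j hj)).mono fun _ h => h.le)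
  filter_upwards [hev, self_mem_nhdsWithin] with t ht htd
  obtain ⟨hint, hpend⟩ := qoaPending_eq q J' r w d t hr' htd
  have hft : f t = ∫ x in Set.Iic t, qoaSpeed q J' r w d x := by
    have hfil : J'.filter (r · ≤ t) = J' := Finset.filter_true_of_mem ht
    have h1 : f t = ∑ j ∈ J', w j - ∑ j ∈ J', w j * ((d - t) / (d - r j)) ^ q :=
      Finset.sum_sub_distrib _ _
    rw [qoaPending, hfil] at hpend
    linarith
  rw [hft, ofReal_integral_eq_lintegral_ofReal hint
    (Filter.Eventually.of_forall (qoaSpeed_nonneg hq hw' hr')),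
    ← lintegral_indicator measurableSet_Iic, ← lintegral_indicator measurableSet_Ico]
  refine lintegral_mono fun x => ?_
  by_cases hx : x ∈ Set.Ico y d
  · rw [Set.indicator_of_mem hx]
    exact (Set.indicator_le_self' (fun _ _ => zero_le) x).trans
      (ENNReal.ofReal_le_ofReal (qoaSpeed_mono hq hw hr hJ x))
  · rw [Set.indicator_of_notMem hx]
    by_cases hxt : x ∈ Set.Iic t
    · have hxd : x < d := lt_of_le_of_lt hxt htd
      have hxy : x < y := by
        by_contra h
        exact hx ⟨not_lt.1 h, hxd⟩
      have hfil : J'.filter (r · ≤ x) = ∅ := Finset.filter_false_of_mem fun j hj => by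
        have := (Finset.mem_filter.1 hj).2
        linarith
      rw [Set.indicator_of_mem hxt, qoaSpeed, qoaPending, hfil]
      simp
    · rw [Set.indicator_of_notMem hxt]

end QOA

/-! ### Comparison schedules for the actual instance and the energy of the whole phase. -/

namespace Instance

variable {I : Instance}

theorem w_nonneg_range (I : Instance) : ∀ j ∈ Finset.range I.n, 0 ≤ I.w j :=
  fun j hj => I.w_nonneg j (Finset.mem_range.1 hj)

theorem r_lt_range (I : Instance) : ∀ j ∈ Finset.range I.n, I.r j < I.d :=
  fun j hj => I.release_lt j (Finset.mem_range.1 hj)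

theorem measurable_yds : Measurable I.yds := measurable_ydsSpeed I.w_nonneg_range I.r_lt_range

theorem yds_nonneg (t : ℝ) : 0 ≤ I.yds t := ydsSpeed_nonneg I.w_nonneg_range I.r_lt_range t

theorem tailWork_le_lintegral_yds (y : ℝ) :
    ENNReal.ofReal (tailWork (Finset.range I.n) I.r I.w y) ≤
      ∫⁻ t in Set.Ico y I.d, ENNReal.ofReal (I.yds t) := by
  have hint : Integrable I.yds := integrable_ydsSpeed I.w_nonneg_range I.r_lt_range
  rw [← ofReal_integral_eq_lintegral_ofReal hint.integrableOn
    (Filter.Eventually.of_forall yds_nonneg)]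
  refine ENNReal.ofReal_le_ofReal
    ((tailWork_le_integral_ydsSpeed I.w_nonneg_range I.r_lt_range y).trans_eq ?_)
  refine setIntegral_eq_of_subset_of_forall_sdiff_eq_zero measurableSet_Ici
    Set.Ico_subset_Ici_self fun t ht => ydsSpeed_eq_zero I.w_nonneg_range I.r_lt_range ?_
  by_contra h
  exact ht.2 ⟨ht.1, not_le.1 h⟩

theorem tailWork_le_lintegral_of_feasible {S : Schedule}
    (hS : S.Feasible (Finset.range I.n) I.r I.w I.d) (y : ℝ) :
    ENNReal.ofReal (tailWork (Finset.range I.n) I.r I.w y) ≤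
      ∫⁻ t in Set.Ico y I.d, ENNReal.ofReal (S.speed t) := by
  let A : ℕ → Set ℝ := fun j => {t | t ∈ Set.Icc (I.r j) I.d ∧ S.job t = some j}
  have hA : ∀ j, MeasurableSet (A j) := fun j => measurableSet_Icc.inter (S.measurableSet_job j)
  unfold tailWork
  rw [ENNReal.ofReal_sum_of_nonneg
    fun j hj => I.w_nonneg_range j (Finset.mem_filter.1 hj).1]
  calc ∑ j ∈ Finset.range I.n with y ≤ I.r j, ENNReal.ofReal (I.w j)
      ≤ ∑ j ∈ Finset.range I.n with y ≤ I.r j, ∫⁻ t in A j, ENNReal.ofReal (S.speed t) :=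
        Finset.sum_le_sum fun j hj => hS j (Finset.mem_filter.1 hj).1
    _ = ∫⁻ t in ⋃ j ∈ (Finset.range I.n).filter (y ≤ I.r ·), A j,
          ENNReal.ofReal (S.speed t) := by
        refine (lintegral_biUnion_finset (fun i _ j _ hij => ?_) (fun j _ => hA j) _).symm
        exact Set.disjoint_left.2 fun t h1 h2 =>
          hij (Option.some_injective _ (h1.2.symm.trans h2.2))
    _ ≤ ∫⁻ t in Set.Icc y I.d, ENNReal.ofReal (S.speed t) := by
        refine lintegral_mono_set (Set.iUnion₂_subset fun j hj t ht => ?_)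
        exact ⟨(Finset.mem_filter.1 hj).2.trans ht.1.1, ht.1.2⟩
    _ = ∫⁻ t in Set.Ico y I.d, ENNReal.ofReal (S.speed t) :=
        setLIntegral_congr Ico_ae_eq_Icc.symm

section Follow

variable {lam α : ℝ} (hlam : lam < 1) (hα : 1 < α) (τ : ℕ → Equiv.Perm ℕ)
  (hk : I.switch lam ≤ I.n) (hpred : ∀ i < I.switch lam, I.r i ≤ I.shrunk lam i)
include hlam hα hk hpred

theorem ftpSpeed_part_nonneg {i : ℕ} (hi : i < I.switch lam) (S : Set ℝ) (t : ℝ) :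
    0 ≤ S.indicator (I.stepSpeed lam τ i) t :=
  Set.indicator_nonneg (fun t _ => ydsSpeed_nonneg
    (stepWork_nonneg (follow_energy hlam hα τ hk hpred i hi).1) (stepRelease_lt hlam i) t) t

theorem ftpSpeed_nonneg (t : ℝ) : 0 ≤ I.ftpSpeed lam τ t := by
  rw [ftpSpeed_eq]
  exact Finset.sum_nonneg fun i hi =>
    ftpSpeed_part_nonneg hlam hα τ hk hpred (Finset.mem_range.1 hi) _ t

/-- The executed parts have disjoint supports, since each profile stops when the next starts, so the
power of the sum is the sum of the powers. -/
theorem energy_ftpSpeed : energy α (I.ftpSpeed lam τ) =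
    ENNReal.ofReal (∑ i ∈ Finset.range (I.switch lam), ∫ t,
      (I.stepTimes lam τ i (I.stepEnd (I.switch lam) i)).indicator
        (I.stepSpeed lam τ i) t ^ α) := by
  set k := I.switch lam with hkdef
  have h0 : (0 : ℝ) ^ α = 0 := Real.zero_rpow (by linarith)
  have hpow : (fun t => I.ftpSpeed lam τ t ^ α) = fun t => ∑ i ∈ Finset.range k,
      (I.stepTimes lam τ i (I.stepEnd k i)).indicator (I.stepSpeed lam τ i) t ^ α := by
    funext t
    rw [ftpSpeed_eq, ← hkdef]
    by_cases hex : ∃ i ∈ Finset.range k, t ∈ I.stepTimes lam τ i (I.stepEnd k i)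
    · obtain ⟨i, hi, hti⟩ := hex
      have hother : ∀ j ∈ Finset.range k, j ≠ i → t ∉ I.stepTimes lam τ j (I.stepEnd k j) := by
        have key : ∀ a b, a < b → b < k → t ∈ I.stepTimes lam τ a (I.stepEnd k a) →
            t ∈ I.stepTimes lam τ b (I.stepEnd k b) → False := by
          intro a b hab hb ha1 hb1
          have h1 : t < I.r (a + 1) := by
            have := ha1.2
            rwa [stepEnd, if_pos (by omega)] at this
          have h2 : I.r b ≤ t := by
            have := hb1.1.1
            rwa [stepRelease, if_pos rfl] at this
          have h3 : I.r (a + 1) ≤ I.r b := r_mono hab (by omega)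
          linarith
        intro j hj hji htj
        rcases lt_or_gt_of_ne hji with h | h
        · exact key j i h (Finset.mem_range.1 hi) htj hti
        · exact key i j h (Finset.mem_range.1 hj) hti htj
      rw [Finset.sum_eq_single_of_mem i hi fun j hj hji =>
          Set.indicator_of_notMem (hother j hj hji) _,
        Finset.sum_eq_single_of_mem i hi fun j hj hji => by
          rw [Set.indicator_of_notMem (hother j hj hji), h0]]
    · push Not at hex
      rw [Finset.sum_eq_zero fun i hi => Set.indicator_of_notMem (hex i hi) _,
        Finset.sum_eq_zero fun i hi => by rw [Set.indicator_of_notMem (hex i hi), h0], h0]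
  have hint : ∀ i ∈ Finset.range k, Integrable fun t =>
      (I.stepTimes lam τ i (I.stepEnd k i)).indicator (I.stepSpeed lam τ i) t ^ α := by
    intro i hi
    have hw := stepWork_nonneg (I := I) (i := i) 
      (follow_energy hlam hα τ hk hpred i (Finset.mem_range.1 hi)).1
    exact integrable_indicator_ydsSpeed_rpow hw (stepRelease_lt hlam i) hα
      (measurableSet_ydsTimes hw (stepRelease_lt hlam i) (τ i) _)
  rw [energy_eq_ofReal (ftpSpeed_nonneg hlam hα τ hk hpred)
    (by rw [hpow]; exact integrable_finsetSum _ hint), hpow, integral_finsetSum _ hint]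

theorem energy_ftpSpeed_le {c : ℝ} (hc : 1 ≤ c)
    (hcr : ∀ i < I.switch lam, I.d - I.r i ≤ c * (I.d - I.shrunk lam i)) {s : ℝ → ℝ}
    (hsm : Measurable s) (hs0 : ∀ t, 0 ≤ s t)
    (hA : ∀ y, ENNReal.ofReal (tailWork (Finset.range I.n) I.r I.w y) ≤
      ∫⁻ t in Set.Ico y I.d, ENNReal.ofReal (s t)) :
    energy α (I.ftpSpeed lam τ) ≤ ENNReal.ofReal (c ^ (α - 1)) * energy α s := by
  have hcα : 0 < c ^ (α - 1) := Real.rpow_pos_of_pos (by linarith) _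
  rcases eq_or_ne (energy α s) ⊤ with htop | htop
  · rw [htop, ENNReal.mul_top (ENNReal.ofReal_pos.2 hcα).ne']
    exact le_top
  have hsα : Integrable fun t => s t ^ α := by
    refine ⟨(hsm.pow_const α).aestronglyMeasurable, ?_⟩
    rw [hasFiniteIntegral_iff_ofReal
      (Filter.Eventually.of_forall fun t => Real.rpow_nonneg (hs0 t) α)]
    exact lt_top_iff_ne_top.2 htop
  -- Restricting `s` to a bounded window that starts before all releases keeps the tail
  -- inequalities; there finite energy gives integrability through `s ≤ 1 + s ^ α`.
  obtain ⟨a, had, ha⟩ := exists_lt_forall_lt (Finset.range I.n) I.r I.d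
  set s' := (Set.Ico a I.d).indicator s with hs'
  have hs0' : ∀ t, 0 ≤ s' t := fun t => Set.indicator_nonneg (fun t _ => hs0 t) t
  have hpow : (fun t => s' t ^ α) = (Set.Ico a I.d).indicator fun t => s t ^ α := by
    funext t
    by_cases h : t ∈ Set.Ico a I.d
    · rw [hs', Set.indicator_of_mem h, Set.indicator_of_mem h]
    · rw [hs', Set.indicator_of_notMem h, Set.indicator_of_notMem h,
        Real.zero_rpow (by linarith)]
  have hsα' : Integrable fun t => s' t ^ α := by
    rw [hpow]
    exact hsα.indicator measurableSet_Ico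
  have hint : IntegrableOn s (Set.Ico a I.d) := by
    refine Integrable.mono' ((integrableOn_const (C := (1 : ℝ)) (by simp)).add
      hsα.integrableOn) hsm.aestronglyMeasurable (Filter.Eventually.of_forall fun t => ?_)
    rw [Real.norm_of_nonneg (hs0 t)]
    simp only [Pi.add_apply]
    rcases le_total (s t) 1 with h | h
    · linarith [Real.rpow_nonneg (hs0 t) α]
    · linarith [Real.self_le_rpow_of_one_le h hα.le]
  have hmain := follow_energy_le hlam hα τ hk hpred hc hcr
    (hint.integrable_indicator measurableSet_Ico) hs0' hsα' (by
      intro y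
      have h1 : tailWork (Finset.range I.n) I.r I.w y ≤
          tailWork (Finset.range I.n) I.r I.w (max y a) := by
        refine le_of_eq ?_
        unfold tailWork
        congr 1
        refine Finset.filter_congr fun j hj => ?_
        have := ha j hj
        simp only [max_le_iff, this.le, and_true]
      have h2 : ∫ t in Set.Ico y I.d, s' t = ∫ t in Set.Ico (max y a) I.d, s t := by
        rw [hs', setIntegral_indicator measurableSet_Ico, Set.Ico_inter_Ico, min_self]
      have hint' : IntegrableOn s (Set.Ico (max y a) I.d) :=
        hint.mono_set (Set.Ico_subset_Ico_left (le_max_right _ _))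
      have h3 := hA (max y a)
      rw [← ofReal_integral_eq_lintegral_ofReal hint' (Filter.Eventually.of_forall hs0),
        ENNReal.ofReal_le_ofReal_iff (integral_nonneg hs0)] at h3
      rw [← hs', h2]
      exact h1.trans h3)
  rw [energy_ftpSpeed hlam hα τ hk hpred]
  refine (ENNReal.ofReal_le_ofReal hmain).trans ?_
  rw [ENNReal.ofReal_mul hcα.le, ← energy_eq_ofReal hs0' hsα']
  gcongr
  exact energy_mono hα hs0' fun t => Set.indicator_le_self' (fun t _ => hs0 t) t

end Follow

/-! ### Predictions and the switch to recovery mode -/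

theorem switch_le (lam : ℝ) : I.switch lam ≤ I.n := Nat.sInf_le (Or.inl le_rfl)

theorem err_le_of_lt_switch {lam : ℝ} {i : ℕ} (hi : i < I.switch lam) : I.err i ≤ lam := by
  have h := Nat.notMem_of_lt_sInf hi
  simp only [Set.mem_ofPred_eq, not_or, not_lt] at h
  exact h.2

theorem err_nonneg {i : ℕ} (hi : i < I.n) : 0 ≤ I.err i :=
  div_nonneg (abs_nonneg _) (sub_pos.2 (I.p_lt i hi)).le

theorem maxErr_nonneg : 0 ≤ I.maxErr := Real.iSup_nonneg fun i => err_nonneg i.2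

theorem err_le_maxErr {i : ℕ} (hi : i < I.n) : I.err i ≤ I.maxErr :=
  le_ciSup (f := fun i : Fin I.n => I.err i) (Set.finite_range _).bddAbove ⟨i, hi⟩

theorem switch_eq {lam : ℝ} (h : I.maxErr ≤ lam) : I.switch lam = I.n := by
  refine le_antisymm (switch_le lam) (not_lt.1 fun hlt => ?_)
  have hmem : I.switch lam ∈ {i | I.n ≤ i ∨ lam < I.err i} :=
    Nat.sInf_mem ⟨I.n, Or.inl le_rfl⟩
  rcases hmem with h1 | h1
  · omega
  · linarith [err_le_maxErr hlt]

/-- Rounding down is harmless because release times are integers. -/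
theorem release_le_shrunk {lam : ℝ} {i : ℕ} (hi : i < I.n) (h : I.err i ≤ lam) :
    I.r i ≤ I.shrunk lam i := by
  rw [err, div_le_iff₀ (sub_pos.2 (I.p_lt i hi))] at h
  refine Int.cast_le.2 (Int.le_floor.2 ?_)
  have := (abs_le.1 h).1
  simp only [Instance.r] at this
  linarith

/-- The error bound gives `d - r ≤ (1 + e) * (d - p)`, while shrinking leaves `d - p' ≥ (1 - lam) *
(d - p)`; rounding down only helps. -/
theorem sub_release_le {lam e : ℝ} (hlam : lam < 1) (he : 0 ≤ e) {i : ℕ} (hi : i < I.n)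
    (h : I.err i ≤ e) :
    I.d - I.r i ≤ (1 + e) / (1 - lam) * (I.d - I.shrunk lam i) := by
  rw [err, div_le_iff₀ (sub_pos.2 (I.p_lt i hi))] at h
  have h1 := (abs_le.1 h).2
  have h2 : I.shrunk lam i ≤ I.p i + lam * (I.d - I.p i) := Int.floor_le _
  have h3 : (1 - lam) * (I.d - I.p i) ≤ I.d - I.shrunk lam i := by linarith
  have hl : 0 < 1 - lam := by linarith
  rw [div_mul_eq_mul_div, le_div_iff₀ hl]
  have h4 : (1 + e) * ((1 - lam) * (I.d - I.p i)) ≤ (1 + e) * (I.d - I.shrunk lam i) :=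
    mul_le_mul_of_nonneg_left h3 (by linarith)
  have h5 : (I.d - I.r i) * (1 - lam) ≤ ((1 + e) * (I.d - I.p i)) * (1 - lam) :=
    mul_le_mul_of_nonneg_right (by linarith) hl.le
  linarith

theorem energy_ftpSpeed_le_of_err_le {lam α e : ℝ} (hα : 1 < α) (hlam0 : 0 ≤ lam)
    (hlam1 : lam < 1) (he : 0 ≤ e) (herr : ∀ i < I.switch lam, I.err i ≤ e)
    (τ : ℕ → Equiv.Perm ℕ) {s : ℝ → ℝ} (hsm : Measurable s) (hs0 : ∀ t, 0 ≤ s t)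
    (hA : ∀ y, ENNReal.ofReal (tailWork (Finset.range I.n) I.r I.w y) ≤
      ∫⁻ t in Set.Ico y I.d, ENNReal.ofReal (s t)) :
    energy α (I.ftpSpeed lam τ) ≤
      ENNReal.ofReal (((1 + e) / (1 - lam)) ^ (α - 1)) * energy α s :=
  energy_ftpSpeed_le hlam1 hα τ (switch_le lam)
    (fun _ hi => release_le_shrunk (hi.trans_le (switch_le lam)) (err_le_of_lt_switch hi))
    ((one_le_div (by linarith)).2 (by linarith))
    (fun i hi => sub_release_le hlam1 he (hi.trans_le (switch_le lam)) (herr i hi)) hsm hs0 hA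

end Instance

end SpeedScaling

/-! ### Combination of the two modes. -/

theorem theorem2 (I : SpeedScaling.Instance) (α lam q : ℝ) (hα : 1 < α)
    (hlam0 : 0 ≤ lam) (hlam1 : lam < 1) (hq : 1 ≤ q) (τ : ℕ → Equiv.Perm ℕ) :
    (I.maxErr ≤ lam →
      SpeedScaling.energy α (I.cdswp lam q τ) ≤
          ENNReal.ofReal (((1 + I.maxErr) / (1 - lam)) ^ (α - 1)) *
            SpeedScaling.energy α I.yds ∧
      ∀ S : SpeedScaling.Schedule, S.Feasible (Finset.range I.n) I.r I.w I.d →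
        SpeedScaling.energy α (I.cdswp lam q τ) ≤
          ENNReal.ofReal (((1 + I.maxErr) / (1 - lam)) ^ (α - 1)) *
            SpeedScaling.energy α S.speed) ∧
    SpeedScaling.energy α (I.cdswp lam q τ) ≤
      ENNReal.ofReal (2 ^ α * ((1 + lam) / (1 - lam)) ^ (α - 1)) *
        SpeedScaling.energy α (I.qoa q 0) := by
  open SpeedScaling SpeedScaling.Instance in
  refine ⟨fun hmax => ?_, ?_⟩
  · have hsw := switch_eq hmax
    have hcd : I.cdswp lam q τ = I.ftpSpeed lam τ := by
      funext t
      simp [cdswp, qoa, qoaSpeed, qoaPending, hsw]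
    have herr : ∀ i < I.switch lam, I.err i ≤ I.maxErr := fun i hi => err_le_maxErr (hsw ▸ hi)
    rw [hcd]
    exact ⟨energy_ftpSpeed_le_of_err_le hα hlam0 hlam1 maxErr_nonneg herr τ measurable_yds
        yds_nonneg tailWork_le_lintegral_yds,
      fun S hS => energy_ftpSpeed_le_of_err_le hα hlam0 hlam1 maxErr_nonneg herr τ
        S.measurable_speed S.speed_nonneg (tailWork_le_lintegral_of_feasible hS)⟩
  · have hw : ∀ j ∈ Finset.Ico 0 I.n, 0 ≤ I.w j := fun j hj =>
      I.w_nonneg j (Finset.mem_Ico.1 hj).2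
    have hr : ∀ j ∈ Finset.Ico 0 I.n, I.r j < I.d := fun j hj =>
      I.release_lt j (Finset.mem_Ico.1 hj).2
    have hsub : Finset.Ico (I.switch lam) I.n ⊆ Finset.Ico 0 I.n :=
      Finset.Ico_subset_Ico_left (Nat.zero_le _)
    have hq0 : ∀ t, 0 ≤ I.qoa q (I.switch lam) t :=
      qoaSpeed_nonneg hq (fun j hj => hw j (hsub hj)) fun j hj => hr j (hsub hj)
    have hftp : energy α (I.ftpSpeed lam τ) ≤
        ENNReal.ofReal (((1 + lam) / (1 - lam)) ^ (α - 1)) * energy α (I.qoa q 0) :=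
      energy_ftpSpeed_le_of_err_le hα hlam0 hlam1 hlam0 (fun i hi => err_le_of_lt_switch hi) τ
        measurable_qoaSpeed (qoaSpeed_nonneg hq hw hr) fun y => by
          rw [Finset.range_eq_Ico]
          exact tailWork_le_lintegral_qoaSpeed hq hw hr y
    have hqoa : energy α (I.qoa q (I.switch lam)) ≤ energy α (I.qoa q 0) :=
      energy_mono hα hq0 (qoaSpeed_mono hq hw hr hsub)
    -- This lets the recovery term be charged at the factor of the prediction term, so the two
    -- together give the second factor `2`.
    have hc1 : 1 ≤ ((1 + lam) / (1 - lam)) ^ (α - 1) :=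
      Real.one_le_rpow ((one_le_div (by linarith)).2 (by linarith)) (by linarith)
    have h2 : (2 : ℝ) ^ α * ((1 + lam) / (1 - lam)) ^ (α - 1) =
        2 ^ (α - 1) * (2 * ((1 + lam) / (1 - lam)) ^ (α - 1)) := by
      rw [Real.rpow_sub_one two_ne_zero]
      ring
    have hftp0 := ftpSpeed_nonneg (I := I) hlam1 hα τ (switch_le lam) fun i hi =>
      release_le_shrunk (hi.trans_le (switch_le lam)) (err_le_of_lt_switch hi)
    refine (energy_add_le hα hftp0 hq0 measurable_qoaSpeed).trans ?_
    rw [h2, ENNReal.ofReal_mul (by positivity), ENNReal.ofReal_mul zero_le_two,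
      ENNReal.ofReal_ofNat, mul_assoc]
    gcongr
    rw [mul_assoc, two_mul]
    refine add_le_add hftp (hqoa.trans ?_)
    exact le_mul_of_one_le_left (zero_le) (ENNReal.one_le_ofReal.2 hc1)
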